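/- For real numbers $x_1,\dots,x_N$ ($N\ge 1$, counted with multiplicity) let \[ D_N(x_1,\dots,x_N)=\sup_{0\le\alpha\le\beta\le 1}\left|\frac{\#\{1\le n\le N:\ \alpha\le\{x_n\}<\beta\}}{N}-(\beta-\alpha)\right| \] denote their discrepancy, where $\{x\}$ is the fractional part of $x$. Let $d\ge 0$ be an integer. There is a constant $C_d>0$, depending only on $d$, such that for every polynomial $P(n)=z_dn^d+\cdots+z_1n+z_0$ of degree $d$ with integer coefficients and every integer $q\ge 1$, \[ D_q\left(\frac{P(1)}{q},\frac{P(2)}{q},\dots,\frac{P(q)}{q}\right)\le C_d\left(\frac{q}{\gcd(z_1,\dots,z_d,q)}\right)^{-1/(d+1)}. \] (For $d=0$ the greatest common divisor is $q$, and the zero polynomial is allowed.) -/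

import Mathlib

/-- The quantities whose supremum is the discrepancy of the real numbers `x 1, …, x N`
(counted with multiplicity): the deviations
`|#{1 ≤ n ≤ N : α ≤ {x n} < β} / N - (β - α)|` for `0 ≤ α ≤ β ≤ 1`. -/
def discrepancyDeviations (N : ℕ) (x : ℕ → ℝ) : Set ℝ :=
  {r : ℝ | ∃ α β : ℝ, 0 ≤ α ∧ α ≤ β ∧ β ≤ 1 ∧
    r = |(({n : ℕ | n ∈ Finset.Icc 1 N ∧ α ≤ Int.fract (x n) ∧ Int.fract (x n) < β}.ncard : ℕ) : ℝ)
          / (N : ℝ) - (β - α)|}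

/-- The discrepancy `D_N (x 1, …, x N)`. -/
noncomputable def discrepancy (N : ℕ) (x : ℕ → ℝ) : ℝ :=
  sSup (discrepancyDeviations N x)

/-- `gcd (z_1, …, z_d, q)` for the coefficients `z_j` of an integer polynomial `P`; the constant
coefficient `z_0` does not enter. -/
noncomputable def coeffGcd (d : ℕ) (P : Polynomial ℤ) (q : ℕ) : ℕ :=
  Nat.gcd ((Finset.Icc 1 d).gcd fun j => (P.coeff j).natAbs) q

/-!
Finite Fourier analysis on `ℤ/q` bounds the discrepancy of the residues `f(1), …, f(q)` by the
complete exponential sums of `k * f` modulo `q` for `1 ≤ k < q`, weighted by `1 / k`. Cancelling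
`gcd(k, q)` leaves a sum for which `f` stays nonconstant modulo every prime factor of the modulus,
and for such `f` of degree at most `d` the sum is `≪ q ^ (1 - 1 / d + ε)`:

* By the Chinese remainder theorem these sums factor over prime powers, and a constant `A` at each
  of them costs only `A ^ ω(q) ≪ q ^ ε`.
* For a prime `p > d` the `p (p - 1)` polynomials `f(l x + m)` with `l ≠ 0` have sums of the same
  absolute value, and at most `d` of them share their nonconstant coefficients. Mordell's mean
  value, the `2 d`-th moment over all coefficient vectors, counts pairs of `d`-tuples with equal
  power sums up to exponent `d`, which are permutations of each other by Newton's identities.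
* For `p ^ l` with `l ≥ 2` write `f' = p ^ τ * F` with `F` nonzero modulo `p`. If `l < 2 * τ + 2`
  then `p ^ l ≤ d ^ 3`. Otherwise only the classes `ξ + p ℤ` at zeros `ξ` of `F` modulo `p` count,
  and `f(ξ + p y) = f(ξ) + p ^ σ * h(y)` reduces such a class to the sum of `h` modulo
  `p ^ (l - σ)`. The reduced derivative of `h` has degree modulo `p` at most the multiplicity of `ξ`
  as a zero of `F`, so the constant does not grow in the induction on `l`.

If `P` has nonconstant coefficients divisible by `g` then `P(n) / (g q) = (ρ + f(n)) / q` with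
`0 ≤ ρ < 1`, and the shift by `ρ` costs at most `1 / q`. This yields every exponent `η < 1 / d`.
-/

open Polynomial
open scoped Matrix Nat

section PowerSums

variable {R ι : Type*} [CommRing R] [IsDomain R] [Fintype ι]

theorem aeval_esymm_eq_of_sum_pow_eq {n : ℕ} (hn : ∀ j, 0 < j → j ≤ n → (j : R) ≠ 0) {x y : ι → R}
    (hxy : ∀ j, 0 < j → j ≤ n → ∑ i, x i ^ j = ∑ i, y i ^ j) {k : ℕ} (hk : k ≤ n) :
    MvPolynomial.aeval x (MvPolynomial.esymm ι R k) =
      MvPolynomial.aeval y (MvPolynomial.esymm ι R k) := by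
  classical
  induction k using Nat.strong_induction_on with
  | _ k ih =>
    rcases Nat.eq_zero_or_pos k with rfl | hpos
    · simp
    have newton (z : ι → R) := congrArg (MvPolynomial.aeval z) (MvPolynomial.mul_esymm_eq_sum ι R k)
    simp only [map_mul, map_natCast, map_sum, map_pow, map_neg, map_one, MvPolynomial.psum,
      MvPolynomial.aeval_X] at newton
    refine mul_left_cancel₀ (hn k hpos hk) ?_
    rw [newton, newton]
    refine congrArg _ (Finset.sum_congr rfl fun ⟨a, b⟩ hab => ?_)
    simp only [Finset.mem_filter, Finset.HasAntidiagonal.mem_antidiagonal] at hab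
    rw [ih a hab.2 (by omega), hxy b (by omega) (by omega)]

theorem map_univ_eq_of_sum_pow_eq
    (hR : ∀ j, 0 < j → j ≤ Fintype.card ι → (j : R) ≠ 0) {x y : ι → R}
    (hxy : ∀ j, 0 < j → j ≤ Fintype.card ι → ∑ i, x i ^ j = ∑ i, y i ^ j) :
    Finset.univ.val.map x = Finset.univ.val.map y := by
  have hprod : ((Finset.univ.val.map x).map fun t => X - C t).prod =
      ((Finset.univ.val.map y).map fun t => X - C t).prod := by
    simp only [Multiset.prod_X_sub_X_eq_sum_esymm, Multiset.card_map, Finset.card_val,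
      ← MvPolynomial.aeval_esymm_eq_multiset_esymm ι R]
    refine Finset.sum_congr rfl fun j hj => ?_
    rw [aeval_esymm_eq_of_sum_pow_eq hR hxy (Finset.mem_range_succ_iff.mp hj)]
  simpa only [roots_multiset_prod_X_sub_C] using congrArg roots hprod

end PowerSums

theorem card_map_univ_eq_le_factorial {α : Type*} [DecidableEq α] [Fintype α] {n : ℕ}
    (x : Fin n → α) :
    (Finset.univ.filter fun y : Fin n → α =>
      Finset.univ.val.map x = Finset.univ.val.map y).card ≤ n ! := by
  calc _ ≤ (List.ofFn x).permutations.toFinset.card := by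
        refine Finset.card_le_card_of_injOn List.ofFn (fun y hy => ?_) List.ofFn_injective.injOn
        simpa [Fin.univ_val_map, List.perm_comm] using hy
    _ ≤ (List.ofFn x).permutations.length := List.toFinset_card_le _
    _ = n ! := by rw [List.length_permutations, List.length_ofFn]

section MeanValue

theorem addChar_map_sum {A M ι : Type*} [AddCommMonoid A] [CommMonoid M] (ψ : AddChar A M)
    (s : Finset ι) (g : ι → A) : ψ (∑ i ∈ s, g i) = ∏ i ∈ s, ψ (g i) :=
  map_prod ψ.toMonoidHom (fun i => Multiplicative.ofAdd (g i)) s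

variable {R ι : Type*} [CommRing R] [Fintype R] [Fintype ι] [DecidableEq ι]

theorem sum_addChar_dotProduct {S : Type*} [CommRing S] [IsDomain S] [DecidableEq R]
    {ψ : AddChar R S} (hψ : ψ.IsPrimitive) (c : ι → R) :
    ∑ a : ι → R, ψ (a ⬝ᵥ c) = if c = 0 then (Fintype.card R : S) ^ Fintype.card ι else 0 := by
  simp only [dotProduct, addChar_map_sum]
  rw [← Fintype.prod_sum (fun j t => ψ (t * c j))]
  simp only [AddChar.sum_mulShift _ hψ]
  split_ifs with hc
  · simp [hc]
  · obtain ⟨j, hj⟩ := Function.ne_iff.mp hc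
    exact Finset.prod_eq_zero (Finset.mem_univ j) (by simp [show c j ≠ 0 from hj])

theorem norm_sum_addChar_pow_two_mul {A α : Type*} [AddCommGroup A] [Finite A] [Fintype α]
    (ψ : AddChar A ℂ) (g : α → A) (m : ℕ) :
    ((‖∑ x, ψ (g x)‖ ^ (2 * m) : ℝ) : ℂ) =
      ∑ x : Fin m → α, ∑ y : Fin m → α, ψ (∑ i, g (x i) - ∑ i, g (y i)) := by
  rw [pow_mul, Complex.ofReal_pow, Complex.ofReal_pow, ← Complex.mul_conj', mul_pow, map_sum]
  simp only [← AddChar.map_neg_eq_conj]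
  rw [Fintype.sum_pow, Fintype.sum_pow, Fintype.sum_mul_sum]
  simp only [← addChar_map_sum, ← AddChar.map_add_eq_mul, Finset.sum_neg_distrib, ← sub_eq_add_neg]

theorem sum_norm_sum_addChar_dotProduct_pow {α : Type*} [Fintype α] [DecidableEq R]
    {ψ : AddChar R ℂ} (hψ : ψ.IsPrimitive) (v : α → ι → R) (m : ℕ) :
    ∑ a : ι → R, ‖∑ x, ψ (a ⬝ᵥ v x)‖ ^ (2 * m) =
      (Fintype.card R : ℝ) ^ Fintype.card ι *
        ∑ x : Fin m → α, ((Finset.univ.filter fun y : Fin m → α =>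
          ∑ i, v (x i) = ∑ i, v (y i)).card : ℝ) := by
  rw [← Complex.ofReal_inj, Complex.ofReal_sum]
  simp only [norm_sum_addChar_pow_two_mul, ← dotProduct_sum, ← dotProduct_sub]
  rw [Finset.sum_comm]
  push_cast
  rw [Finset.mul_sum]
  refine Finset.sum_congr rfl fun x _ => ?_
  rw [Finset.sum_comm]
  simp only [sum_addChar_dotProduct hψ, sub_eq_zero]
  rw [← Finset.sum_filter, Finset.sum_const, nsmul_eq_mul, mul_comm]

/-- The exponential sum attached to the polynomial `∑ j, a j * X ^ (j + 1)` without constant term;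
Mordell's argument averages it over all coefficient vectors `a`. -/
def weylSum {d : ℕ} (ψ : AddChar R ℂ) (a : Fin d → R) : ℂ :=
  ∑ x, ψ (a ⬝ᵥ fun j => x ^ (j.1 + 1))

theorem sum_norm_weylSum_pow_le [IsDomain R] {d : ℕ}
    (hR : ∀ j, 0 < j → j ≤ d → (j : R) ≠ 0) {ψ : AddChar R ℂ} (hψ : ψ.IsPrimitive) :
    ∑ a : Fin d → R, ‖weylSum ψ a‖ ^ (2 * d) ≤ d ! * (Fintype.card R : ℝ) ^ (2 * d) := by
  classical
  have same_powerSums (x : Fin d → R) : (Finset.univ.filter fun y : Fin d → R =>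
      ∑ i, (fun j : Fin d => x i ^ (j.1 + 1)) = ∑ i, fun j : Fin d => y i ^ (j.1 + 1)).card ≤
        d ! := by
    refine le_trans (Finset.card_le_card fun y hy => ?_) (card_map_univ_eq_le_factorial x)
    simp only [Finset.mem_filter_univ] at hy ⊢
    refine map_univ_eq_of_sum_pow_eq (by simpa using hR) fun j hj hjd => ?_
    simpa [Nat.sub_add_cancel hj] using congrFun hy ⟨j - 1, by simp at hjd; omega⟩
  calc _ = (Fintype.card R : ℝ) ^ d * ∑ x : Fin d → R, ((Finset.univ.filter fun y : Fin d → R =>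
          ∑ i, (fun j : Fin d => x i ^ (j.1 + 1)) = ∑ i, fun j : Fin d => y i ^ (j.1 + 1)).card
            : ℝ) := by
        simpa [weylSum] using sum_norm_sum_addChar_dotProduct_pow hψ
          (fun x (j : Fin d) => x ^ (j.1 + 1)) d
    _ ≤ (Fintype.card R : ℝ) ^ d * ∑ _x : Fin d → R, (d ! : ℝ) := by
        gcongr with x
        exact same_powerSums x
    _ = d ! * (Fintype.card R : ℝ) ^ (2 * d) := by
        simp; ring

end MeanValue

section Mordell

theorem coeff_natDegree_sub_one_taylor {R : Type*} [CommSemiring R] (f : R[X]) (μ : R)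
    (hf : 0 < f.natDegree) :
    (taylor μ f).coeff (f.natDegree - 1) =
      f.coeff (f.natDegree - 1) + f.natDegree * f.leadingCoeff * μ := by
  have hdeg := natDegree_hasseDeriv_le f (f.natDegree - 1)
  have hchoose : f.natDegree.choose (f.natDegree - 1) = f.natDegree := by
    rw [Nat.choose_symm hf, Nat.choose_one_right]
  rw [taylor_coeff, eval_eq_sum_range' (n := 2) (by omega), Finset.sum_range_succ,
    Finset.sum_range_one]
  simp [hasseDeriv_coeff, Nat.add_sub_cancel' hf, hchoose]

/-- The coefficients of `X, X ^ 2, …, X ^ d` in `f (l * X + m)`. -/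
noncomputable def affineCoeffs {R : Type*} [CommSemiring R] (d : ℕ) (f : R[X]) (l m : R) :
    Fin d → R :=
  fun j => l ^ (j.1 + 1) * (taylor m f).coeff (j.1 + 1)

variable {K : Type*} [Field K] [Fintype K]

theorem eval_mul_add_eq_affineCoeffs {R : Type*} [CommRing R] (f : R[X]) (l m x : R) :
    f.eval (l * x + m) =
      f.eval m + affineCoeffs f.natDegree f l m ⬝ᵥ fun j => x ^ (j.1 + 1) := by
  rw [← taylor_eval, eval_eq_sum_range, natDegree_taylor, Finset.sum_range_succ',
    Finset.sum_range, add_comm]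
  simp only [taylor_coeff_zero, pow_zero, mul_one, dotProduct, affineCoeffs, mul_pow]
  exact congrArg _ (Finset.sum_congr rfl fun j _ => by ring)

theorem norm_weylSum_affineCoeffs (f : K[X]) (ψ : AddChar K ℂ) {l : K} (hl : l ≠ 0) (m : K) :
    ‖weylSum ψ (affineCoeffs f.natDegree f l m)‖ = ‖∑ x, ψ (f.eval x)‖ := by
  have hreparam : ∑ x, ψ (f.eval (l * x + m)) = ∑ x, ψ (f.eval x) :=
    Fintype.sum_equiv ((Equiv.mulLeft₀ l hl).trans (Equiv.addRight m)) _ _ fun x => by simp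
  simp only [← hreparam, eval_mul_add_eq_affineCoeffs, AddChar.map_add_eq_mul, ← Finset.mul_sum,
    norm_mul, AddChar.norm_apply, one_mul, weylSum]

theorem card_affineCoeffs_fiber_le [DecidableEq K] {f : K[X]} (hf : 2 ≤ f.natDegree)
    (hK : (f.natDegree : K) ≠ 0) (a : Fin f.natDegree → K) :
    (Finset.univ.filter fun t : K × K =>
      t.1 ≠ 0 ∧ affineCoeffs f.natDegree f t.1 t.2 = a).card ≤ f.natDegree := by
  have hf0 : f ≠ 0 := by rintro rfl; simp at hf
  have hlead : f.leadingCoeff ≠ 0 := leadingCoeff_ne_zero.mpr hf0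
  have coeff_top (l m : K) : affineCoeffs f.natDegree f l m ⟨f.natDegree - 1, by omega⟩ =
      l ^ f.natDegree * f.leadingCoeff := by
    simp only [affineCoeffs, Nat.sub_add_cancel (one_le_two.trans hf), coeff_taylor_natDegree]
  have coeff_next (l m : K) : affineCoeffs f.natDegree f l m ⟨f.natDegree - 2, by omega⟩ =
      l ^ (f.natDegree - 1) *
        (f.coeff (f.natDegree - 1) + f.natDegree * f.leadingCoeff * m) := by
    simp only [affineCoeffs, show f.natDegree - 2 + 1 = f.natDegree - 1 by omega,
      coeff_natDegree_sub_one_taylor f m (by omega)]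
  calc _ ≤ (nthRoots f.natDegree
          (a ⟨f.natDegree - 1, by omega⟩ / f.leadingCoeff)).toFinset.card := by
        refine Finset.card_le_card_of_injOn Prod.fst ?_ ?_
        · rintro ⟨l, m⟩ h
          obtain ⟨-, ha⟩ := (Finset.mem_filter_univ _).mp h
          have htop := congrFun ha ⟨f.natDegree - 1, by omega⟩
          rw [coeff_top] at htop
          simpa [mem_nthRoots (show 0 < f.natDegree by omega), eq_div_iff hlead] using htop
        · rintro ⟨l, m⟩ h ⟨l', m'⟩ h' (rfl : l = l')
          obtain ⟨hl : l ≠ 0, ha⟩ := (Finset.mem_filter_univ _).mp h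
          obtain ⟨-, ha'⟩ := (Finset.mem_filter_univ _).mp h'
          have hnext := congrFun (ha.trans ha'.symm) ⟨f.natDegree - 2, by omega⟩
          rw [coeff_next, coeff_next] at hnext
          simpa [hl, hK, hf0] using hnext
    _ ≤ Multiset.card (nthRoots f.natDegree
          (a ⟨f.natDegree - 1, by omega⟩ / f.leadingCoeff)) := Multiset.toFinset_card_le _
    _ ≤ f.natDegree := card_nthRoots _ _

theorem norm_sum_addChar_eval_pow_le {f : K[X]} (hf : 2 ≤ f.natDegree)
    (hK : ∀ j, 0 < j → j ≤ f.natDegree → (j : K) ≠ 0) {ψ : AddChar K ℂ} (hψ : ψ.IsPrimitive) :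
    Fintype.card K * (Fintype.card K - 1) * ‖∑ x, ψ (f.eval x)‖ ^ (2 * f.natDegree) ≤
      f.natDegree * (f.natDegree ! * (Fintype.card K : ℝ) ^ (2 * f.natDegree)) := by
  classical
  set d := f.natDegree
  set T : Finset (K × K) := Finset.univ.filter fun t => t.1 ≠ 0
  have hT : (T.card : ℝ) = Fintype.card K * (Fintype.card K - 1) := by
    have : T = (Finset.univ.erase 0) ×ˢ Finset.univ := by
      ext ⟨a, b⟩; simp [T]
    rw [this, Finset.card_product, Finset.card_erase_of_mem (Finset.mem_univ _), Finset.card_univ]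
    push_cast [Nat.cast_sub Fintype.card_pos]
    ring
  calc _ = ∑ t ∈ T, ‖weylSum ψ (affineCoeffs d f t.1 t.2)‖ ^ (2 * d) := by
        rw [← hT, ← nsmul_eq_mul, ← Finset.sum_const]
        refine Finset.sum_congr rfl fun t ht => ?_
        rw [norm_weylSum_affineCoeffs f ψ (Finset.mem_filter.mp ht).2]
    _ = ∑ a, ∑ t ∈ T with affineCoeffs d f t.1 t.2 = a, ‖weylSum ψ a‖ ^ (2 * d) := by
        rw [← Finset.sum_fiberwise T fun t => affineCoeffs d f t.1 t.2]
        refine Finset.sum_congr rfl fun a _ => Finset.sum_congr rfl fun t ht => ?_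
        rw [(Finset.mem_filter.mp ht).2]
    _ ≤ ∑ a : Fin d → K, d * ‖weylSum ψ a‖ ^ (2 * d) := by
        refine Finset.sum_le_sum fun a _ => ?_
        rw [Finset.sum_const, nsmul_eq_mul, Finset.filter_filter]
        gcongr
        exact card_affineCoeffs_fiber_le hf (hK d (by omega) le_rfl) a
    _ ≤ _ := by
        rw [← Finset.mul_sum]
        gcongr
        exact sum_norm_weylSum_pow_le hK hψ

theorem sum_addChar_eval_eq_zero {f : K[X]} (hf : f.natDegree = 1) {ψ : AddChar K ℂ}
    (hψ : ψ.IsPrimitive) : ∑ x, ψ (f.eval x) = 0 := by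
  classical
  obtain ⟨a, ha, b, rfl⟩ := natDegree_eq_one.mp hf
  simp only [eval_add, eval_mul, eval_C, eval_X, AddChar.map_add_eq_mul, ← Finset.sum_mul]
  simp only [mul_comm a, AddChar.sum_mulShift a hψ, if_neg ha, Nat.cast_zero, zero_mul]

theorem norm_sum_addChar_eval_le {f : K[X]} (hf : 0 < f.natDegree)
    (hK : ∀ j, 0 < j → j ≤ f.natDegree → (j : K) ≠ 0) {ψ : AddChar K ℂ} (hψ : ψ.IsPrimitive) :
    ‖∑ x, ψ (f.eval x)‖ ≤ 2 * f.natDegree * f.natDegree ! *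
      (Fintype.card K : ℝ) ^ (1 - 1 / (f.natDegree : ℝ)) := by
  rcases (Nat.succ_le_of_lt hf).eq_or_lt with hd | hd
  · rw [sum_addChar_eval_eq_zero hd.symm hψ, norm_zero]; positivity
  have h := norm_sum_addChar_eval_pow_le hd hK hψ
  set d := f.natDegree
  set s := ‖∑ x, ψ (f.eval x)‖
  set Q : ℝ := (Fintype.card K : ℝ)
  have hQ : 2 ≤ Q := Nat.ofNat_le_cast.mpr Fintype.one_lt_card
  have hc : (1 : ℝ) ≤ 2 * d * d ! := by
    exact_mod_cast Nat.one_le_iff_ne_zero.mpr (by positivity)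
  refine le_of_pow_le_pow_left₀ (n := 2 * d) (by omega) (by positivity) ?_
  calc s ^ (2 * d) ≤ 2 * d * d ! * Q ^ (2 * d - 2) := by
        have hhalf : Q ^ 2 / 2 * s ^ (2 * d) ≤ Q * (Q - 1) * s ^ (2 * d) := by
          gcongr; nlinarith
        have hQpow : Q ^ (2 * d) = Q ^ (2 * d - 2) * Q ^ 2 := by rw [← pow_add]; congr 1; omega
        rw [hQpow] at h
        exact le_of_mul_le_mul_right (a := Q ^ 2) (by linarith) (by positivity)
    _ ≤ (2 * d * d !) ^ (2 * d) * Q ^ (2 * d - 2) := by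
        gcongr; exact le_self_pow₀ hc (by omega)
    _ = (2 * d * d ! * Q ^ (1 - 1 / (d : ℝ))) ^ (2 * d) := by
        rw [mul_pow _ (Q ^ _), ← Real.rpow_mul_natCast (by positivity), ← Real.rpow_natCast Q]
        push_cast [Nat.cast_sub (show 2 ≤ 2 * d by omega)]
        field_simp

end Mordell

section RangeSums

variable {M : Type*} [AddCommMonoid M]

theorem sum_range_mul (F : ℕ → M) (a b : ℕ) :
    ∑ x ∈ Finset.range (a * b), F x =
      ∑ y ∈ Finset.range a, ∑ z ∈ Finset.range b, F (y + a * z) := by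
  rw [Finset.sum_comm]
  induction b with
  | zero => simp
  | succ b ih =>
    rw [mul_add_one, Finset.sum_range_add, ih, Finset.sum_range_succ]
    simp only [add_comm]

theorem sum_range_mul_of_periodic {F : ℕ → M} {q : ℕ} (hF : Function.Periodic F q) (g : ℕ) :
    ∑ x ∈ Finset.range (q * g), F x = g • ∑ x ∈ Finset.range q, F x := by
  have hper (y z : ℕ) : F (y + q * z) = F y := by rw [mul_comm]; exact hF.nat_mul z y
  simp [sum_range_mul, hper, Finset.smul_sum]

theorem sum_range_natCast_zmod {q : ℕ} [NeZero q] (G : ZMod q → M) :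
    ∑ x ∈ Finset.range q, G x = ∑ x, G x := by
  refine Finset.sum_bij' (fun x _ => (x : ZMod q)) (fun x _ => x.val) ?_ ?_ ?_ ?_ ?_
  · simp
  · exact fun a _ => Finset.mem_range.mpr (ZMod.val_lt a)
  · exact fun a ha => ZMod.val_cast_of_lt (Finset.mem_range.mp ha)
  · simp
  · simp

end RangeSums

section Characters

/-- The additive character `a ↦ exp (2 π i a / q)` of `ℤ`. -/
noncomputable def modChar (q : ℕ) : AddChar ℤ ℂ where
  toFun a := Complex.exp (2 * Real.pi * Complex.I * (a / q))
  map_zero_eq_one' := by simp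
  map_add_eq_mul' a b := by
    rw [← Complex.exp_add]
    push_cast
    ring_nf

theorem modChar_apply (q : ℕ) (a : ℤ) :
    modChar q a = Complex.exp (2 * Real.pi * Complex.I * (a / q)) :=
  rfl

theorem norm_modChar (q : ℕ) (a : ℤ) : ‖modChar q a‖ = 1 := by
  rw [modChar_apply, show 2 * Real.pi * Complex.I * (a / q : ℂ) =
    ((2 * Real.pi * (a / q) : ℝ) : ℂ) * Complex.I by push_cast; ring]
  exact Complex.norm_exp_ofReal_mul_I _

theorem norm_sum_modChar_le {ι : Type*} (s : Finset ι) (q : ℕ) (g : ι → ℤ) :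
    ‖∑ x ∈ s, modChar q (g x)‖ ≤ s.card := by
  refine (norm_sum_le _ _).trans ?_
  simp [norm_modChar]

theorem modChar_natCast_mul (q n : ℕ) (a : ℤ) : modChar q (n * a) = modChar q a ^ n := by
  rw [← nsmul_eq_mul, AddChar.map_nsmul_eq_pow]

theorem modChar_mul_mul_left {r : ℕ} (hr : r ≠ 0) (q : ℕ) (a : ℤ) :
    modChar (r * q) (r * a) = modChar q a := by
  simp only [modChar_apply]
  push_cast
  rw [mul_div_mul_left _ _ (Nat.cast_ne_zero.mpr hr)]

theorem modChar_eq_stdAddChar (q : ℕ) [NeZero q] (a : ℤ) :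
    modChar q a = ZMod.stdAddChar (a : ZMod q) := by
  rw [ZMod.stdAddChar_coe, modChar_apply, mul_div_assoc]

theorem modChar_eq_one_iff {q : ℕ} (hq : q ≠ 0) (a : ℤ) : modChar q a = 1 ↔ (q : ℤ) ∣ a := by
  have : NeZero q := ⟨hq⟩
  rw [modChar_eq_stdAddChar, ← ZMod.intCast_zmod_eq_zero_iff_dvd,
    ← AddChar.map_zero_eq_one (ZMod.stdAddChar (N := q)), ZMod.injective_stdAddChar.eq_iff]

theorem modChar_congr {q : ℕ} {a b : ℤ} (h : a ≡ b [ZMOD q]) : modChar q a = modChar q b := by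
  rcases eq_or_ne q 0 with rfl | hq
  · simp [modChar_apply]
  · have : NeZero q := ⟨hq⟩
    rw [modChar_eq_stdAddChar, modChar_eq_stdAddChar, (ZMod.intCast_eq_intCast_iff a b q).mpr h]

end Characters

section CompleteSums

theorem polynomial_eval_modEq {q x y : ℤ} (h : x ≡ y [ZMOD q]) (f : ℤ[X]) :
    f.eval x ≡ f.eval y [ZMOD q] :=
  Int.modEq_iff_dvd.mpr (h.dvd.trans (f.sub_dvd_eval_sub y x))

/-- The reduction of an integer polynomial modulo `p`. -/
noncomputable abbrev reduceMod (p : ℕ) (f : ℤ[X]) : (ZMod p)[X] :=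
  f.map (Int.castRingHom (ZMod p))

theorem eval_reduceMod (p : ℕ) (f : ℤ[X]) (x : ℤ) :
    (reduceMod p f).eval (x : ZMod p) = f.eval x := by
  simp [eval_intCast_map]

theorem coeff_reduceMod_eq_zero_iff (p : ℕ) (f : ℤ[X]) (j : ℕ) :
    (reduceMod p f).coeff j = 0 ↔ (p : ℤ) ∣ f.coeff j := by
  rw [coeff_map, eq_intCast, ZMod.intCast_zmod_eq_zero_iff_dvd]

/-- The complete exponential sum of an integer polynomial modulo `q`. -/
noncomputable def completeExpSum (q : ℕ) (f : ℤ[X]) : ℂ :=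
  ∑ x ∈ Finset.range q, modChar q (f.eval (x : ℤ))

theorem periodic_modChar_eval (q : ℕ) (f : ℤ[X]) :
    Function.Periodic (fun x : ℕ => modChar q (f.eval (x : ℤ))) q := fun x =>
  modChar_congr (polynomial_eval_modEq (by simp [Int.ModEq]) f)

theorem norm_completeExpSum_le (q : ℕ) (f : ℤ[X]) : ‖completeExpSum q f‖ ≤ q := by
  simpa [completeExpSum] using norm_sum_modChar_le (Finset.range q) q fun x => f.eval (x : ℤ)

theorem completeExpSum_mul_C_mul {g : ℕ} (hg : g ≠ 0) (q : ℕ) (f : ℤ[X]) :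
    completeExpSum (g * q) (C (g : ℤ) * f) = g * completeExpSum q f := by
  simp only [completeExpSum, eval_mul, eval_C, modChar_mul_mul_left hg]
  rw [mul_comm g, sum_range_mul_of_periodic (periodic_modChar_eval q f), nsmul_eq_mul]

theorem completeExpSum_eq_sum_zmod (q : ℕ) [NeZero q] (f : ℤ[X]) :
    completeExpSum q f = ∑ x : ZMod q, ZMod.stdAddChar ((reduceMod q f).eval x) := by
  rw [← sum_range_natCast_zmod, completeExpSum]
  refine Finset.sum_congr rfl fun x _ => ?_
  rw [modChar_eq_stdAddChar, ← eval_reduceMod, Int.cast_natCast]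

/-- The implied constant for prime-power moduli: the first summand comes from Mordell's mean value,
the second from the trivial bound for moduli up to `k ^ 3`. -/
def primePowConst (k : ℕ) : ℝ :=
  2 * k * k.factorial + k ^ 3

theorem norm_completeExpSum_le_of_le_pow_three {q k : ℕ} (hq : 0 < q) (hk : 0 < k)
    (hqk : q ≤ k ^ 3) (f : ℤ[X]) :
    ‖completeExpSum q f‖ ≤ primePowConst k * (q : ℝ) ^ (1 - 1 / (k : ℝ)) := by
  have hexp : 0 ≤ 1 - 1 / (k : ℝ) := by
    rw [one_div]; exact sub_nonneg.mpr (Nat.cast_inv_le_one k)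
  calc ‖completeExpSum q f‖ ≤ q := norm_completeExpSum_le q f
    _ ≤ (k : ℝ) ^ 3 := by exact_mod_cast hqk
    _ ≤ primePowConst k := le_add_of_nonneg_left (by positivity)
    _ ≤ primePowConst k * (q : ℝ) ^ (1 - 1 / (k : ℝ)) :=
        le_mul_of_one_le_right (by unfold primePowConst; positivity)
          (Real.one_le_rpow (Nat.one_le_cast.mpr hq) hexp)

theorem norm_completeExpSum_prime_le {p : ℕ} [Fact p.Prime] {k : ℕ} {f : ℤ[X]}
    (hfk : f.natDegree ≤ k) (hf : 0 < (reduceMod p f).natDegree) :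
    ‖completeExpSum p f‖ ≤ primePowConst k * (p : ℝ) ^ (1 - 1 / (k : ℝ)) := by
  have hp := (Fact.out : p.Prime)
  set e := (reduceMod p f).natDegree
  have hek : e ≤ k := natDegree_map_le.trans hfk
  rcases lt_or_ge e p with hep | hpe
  · have hfactorial : ∀ j, 0 < j → j ≤ e → (j : ZMod p) ≠ 0 := fun j hj hje hj0 =>
      (Nat.le_of_dvd hj ((ZMod.natCast_eq_zero_iff j p).mp hj0)).not_gt (hje.trans_lt hep)
    calc ‖completeExpSum p f‖
        ≤ 2 * e * e.factorial * (p : ℝ) ^ (1 - 1 / (e : ℝ)) := by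
          simpa only [completeExpSum_eq_sum_zmod, ZMod.card] using
            norm_sum_addChar_eval_le hf hfactorial (ZMod.isPrimitive_stdAddChar p)
      _ ≤ 2 * k * k.factorial * (p : ℝ) ^ (1 - 1 / (k : ℝ)) := by
          gcongr
          exact_mod_cast hp.one_lt.le
      _ ≤ primePowConst k * (p : ℝ) ^ (1 - 1 / (k : ℝ)) := by
          gcongr
          exact le_add_of_nonneg_right (by positivity)
  · exact norm_completeExpSum_le_of_le_pow_three hp.pos (by omega)
      ((hpe.trans hek).trans (Nat.le_self_pow three_ne_zero k)) f

end CompleteSums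

section ReducedDerivative

theorem le_of_pow_mul_eq_pow_mul {R : Type*} [CommMonoidWithZero R] [IsCancelMulZero R] {p : R}
    (hp : Prime p) {a b : ℕ} {x y : R} (h : p ^ a * x = p ^ b * y) (hy : ¬ p ∣ y) : a ≤ b := by
  have hdvd : p ^ a ∣ p ^ b := hp.pow_dvd_of_dvd_mul_right a hy (h ▸ dvd_mul_right _ _)
  exact (pow_dvd_pow_iff hp.ne_zero hp.not_isUnit).mp hdvd

theorem exists_eq_C_pow_mul_reduceMod_ne_zero {p : ℕ} (hp : p.Prime) {g : ℤ[X]} (hg : g ≠ 0) :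
    ∃ (n : ℕ) (h : ℤ[X]), g = C ((p : ℤ) ^ n) * h ∧ reduceMod p h ≠ 0 := by
  have hprime : Prime (C (p : ℤ)) := prime_C_iff.mpr (Nat.prime_iff_prime_int.mp hp)
  obtain ⟨n, h, hn, hgh⟩ := WfDvdMonoid.max_power_factor hg hprime.irreducible
  refine ⟨n, h, by rw [hgh, C_pow], fun h0 => hn (C_dvd_iff_dvd_coeff _ _ |>.mpr fun j => ?_)⟩
  rw [← coeff_reduceMod_eq_zero_iff, h0, coeff_zero]

/-- `f' = p ^ τ * F` with `F` not divisible by `p`, i.e. `p ^ τ` is the exact power of `p` dividing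
the content of `f'`. The zeros of `F` modulo `p` are the critical points of `f`. -/
structure IsReducedDerivative (p τ : ℕ) (f F : ℤ[X]) : Prop where
  derivative_eq : derivative f = C ((p : ℤ) ^ τ) * F
  reduceMod_ne_zero : reduceMod p F ≠ 0

variable {p : ℕ} {f : ℤ[X]}

theorem natDegree_pos_of_reduceMod (hf : 0 < (reduceMod p f).natDegree) : 0 < f.natDegree :=
  hf.trans_le natDegree_map_le

theorem exists_isReducedDerivative (hp : p.Prime) (hf : 0 < f.natDegree) :
    ∃ τ F, IsReducedDerivative p τ f F := by
  have hne : derivative f ≠ 0 := fun h0 => hf.ne' (derivative_eq_zero.mp h0)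
  obtain ⟨τ, F, hF, hF0⟩ := exists_eq_C_pow_mul_reduceMod_ne_zero hp hne
  exact ⟨τ, F, hF, hF0⟩

namespace IsReducedDerivative

variable {τ : ℕ} {F : ℤ[X]}

theorem natDegree_reduceMod_le (hF : IsReducedDerivative p τ f F) (hp : p ≠ 0) :
    (reduceMod p F).natDegree ≤ f.natDegree - 1 := by
  refine natDegree_map_le.trans (le_trans (le_of_eq ?_) (natDegree_derivative_le f))
  rw [hF.derivative_eq, natDegree_C_mul (pow_ne_zero _ (Nat.cast_ne_zero.mpr hp))]

theorem pow_dvd_natDegree_reduceMod (hF : IsReducedDerivative p τ f F) (hp : p.Prime)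
    (hf : 0 < (reduceMod p f).natDegree) : p ^ τ ∣ (reduceMod p f).natDegree := by
  obtain ⟨i, hi⟩ : ∃ i, (reduceMod p f).natDegree = i + 1 := ⟨_, (Nat.succ_pred hf.ne').symm⟩
  have hlead : ¬ (p : ℤ) ∣ f.coeff (i + 1) := by
    rw [← coeff_reduceMod_eq_zero_iff, ← hi]
    exact leadingCoeff_ne_zero.mpr (ne_zero_of_natDegree_gt hf)
  have hcoeff : f.coeff (i + 1) * (i + 1) = (p : ℤ) ^ τ * F.coeff i := by
    rw [← coeff_derivative, hF.derivative_eq, coeff_C_mul]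
  have hdvd := (Nat.prime_iff_prime_int.mp hp).pow_dvd_of_dvd_mul_left τ hlead
    (Dvd.intro _ hcoeff.symm)
  rw [hi]
  exact_mod_cast hdvd

end IsReducedDerivative

theorem intCast_dvd_eval_iff_isRoot (F : ℤ[X]) (x : ℤ) :
    (p : ℤ) ∣ F.eval x ↔ (reduceMod p F).IsRoot (x : ZMod p) := by
  rw [IsRoot, eval_reduceMod, ZMod.intCast_zmod_eq_zero_iff_dvd]

/-- The zeros of `F` modulo `p`, as residues `0 ≤ ξ < p`. -/
def residueRoots (p : ℕ) (F : ℤ[X]) : Finset ℕ :=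
  {ξ ∈ Finset.range p | (p : ℤ) ∣ F.eval (ξ : ℤ)}

theorem sum_rootMultiplicity_residueRoots_le [Fact p.Prime] (F : ℤ[X]) :
    ∑ ξ ∈ residueRoots p F, (reduceMod p F).rootMultiplicity (ξ : ZMod p) ≤
      (reduceMod p F).natDegree := by
  classical
  have hinj : Set.InjOn (fun ξ : ℕ => (ξ : ZMod p)) (residueRoots p F) := fun a ha b hb hab => by
    have ha := Finset.mem_range.mp (Finset.mem_filter.mp ha).1
    have hb := Finset.mem_range.mp (Finset.mem_filter.mp hb).1
    exact Nat.ModEq.eq_of_lt_of_lt ((ZMod.natCast_eq_natCast_iff a b p).mp hab) ha hb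
  rw [← Finset.sum_image (f := fun a => (reduceMod p F).rootMultiplicity a) hinj]
  simp only [← count_roots]
  refine le_trans ?_ (card_roots' _)
  rw [← Multiset.toFinset_sum_count_eq]
  exact Finset.sum_le_sum_of_ne_zero fun a _ ha =>
    Multiset.mem_toFinset.mpr (Multiset.count_ne_zero.mp ha)

end ReducedDerivative

section LocalExpansion

theorem derivative_taylor {R : Type*} [CommSemiring R] (r : R) (g : R[X]) :
    derivative (taylor r g) = taylor r (derivative g) := by
  simp [taylor_apply, derivative_comp]

/-- `f (ξ + p * X) = f ξ + p ^ σ * h` with `h` not divisible by `p`: the expansion of `f` on the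
residue class of `ξ` modulo `p`. -/
structure IsLocalExpansion (p : ℕ) (ξ : ℤ) (σ : ℕ) (f h : ℤ[X]) : Prop where
  taylor_comp_eq : (taylor ξ f).comp (C (p : ℤ) * X) = C (f.eval ξ) + C ((p : ℤ) ^ σ) * h
  reduceMod_ne_zero : reduceMod p h ≠ 0

variable {p σ : ℕ} {ξ : ℤ} {f h : ℤ[X]}

theorem exists_isLocalExpansion (hp : p.Prime) (hf : 0 < f.natDegree) (ξ : ℤ) :
    ∃ σ h, IsLocalExpansion p ξ σ f h := by
  have hp0 : (p : ℤ) ≠ 0 := Nat.cast_ne_zero.mpr hp.ne_zero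
  have hne : (taylor ξ f).comp (C (p : ℤ) * X) - C (f.eval ξ) ≠ 0 := fun h0 => by
    have hdeg := congrArg natDegree (sub_eq_zero.mp h0)
    simp only [natDegree_comp, natDegree_taylor, natDegree_C_mul_X _ hp0, natDegree_C] at hdeg
    omega
  obtain ⟨σ, h, hσ, hh⟩ := exists_eq_C_pow_mul_reduceMod_ne_zero hp hne
  exact ⟨σ, h, by rw [← hσ, add_sub_cancel], hh⟩

namespace IsLocalExpansion

theorem eval_add_mul (hh : IsLocalExpansion p ξ σ f h) (y : ℤ) :
    f.eval (ξ + p * y) = f.eval ξ + p ^ σ * h.eval y := by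
  simpa [eval_comp, taylor_eval, add_comm] using congrArg (eval y) hh.taylor_comp_eq

theorem pow_mul_coeff (hh : IsLocalExpansion p ξ σ f h) {j : ℕ} (hj : j ≠ 0) :
    (p : ℤ) ^ σ * h.coeff j = p ^ j * (taylor ξ f).coeff j := by
  have hcoeff := congrArg (coeff · j) hh.taylor_comp_eq
  simp only [comp_C_mul_X_coeff, coeff_add, coeff_C_of_ne_zero hj, coeff_C_mul, zero_add] at hcoeff
  rw [← hcoeff, mul_comm]

theorem coeff_zero_eq (hh : IsLocalExpansion p ξ σ f h) (hp : p ≠ 0) : h.coeff 0 = 0 := by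
  have hcoeff := congrArg (coeff · 0) hh.taylor_comp_eq
  simp only [comp_C_mul_X_coeff, taylor_coeff_zero, coeff_add, coeff_C_zero, coeff_C_mul] at hcoeff
  simpa [hp] using hcoeff

theorem natDegree_le (hh : IsLocalExpansion p ξ σ f h) (hp : p ≠ 0) :
    h.natDegree ≤ f.natDegree := by
  refine natDegree_le_iff_coeff_eq_zero.mpr fun j hj => ?_
  have hcoeff := hh.pow_mul_coeff (show j ≠ 0 by omega)
  rw [coeff_eq_zero_of_natDegree_lt (p := taylor ξ f) (by rwa [natDegree_taylor]), mul_zero]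
    at hcoeff
  exact (mul_eq_zero.mp hcoeff).resolve_left (pow_ne_zero _ (Nat.cast_ne_zero.mpr hp))

theorem natDegree_reduceMod_pos (hh : IsLocalExpansion p ξ σ f h) (hp : p ≠ 0) :
    0 < (reduceMod p h).natDegree := by
  refine Nat.pos_of_ne_zero fun hdeg => hh.reduceMod_ne_zero ?_
  rw [eq_C_of_natDegree_eq_zero hdeg, coeff_map, hh.coeff_zero_eq hp, map_zero, C_0]

theorem pos (hh : IsLocalExpansion p ξ σ f h) (hp : p.Prime) : 0 < σ := by
  have hj := hh.natDegree_reduceMod_pos hp.ne_zero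
  refine hj.trans_le (le_of_pow_mul_eq_pow_mul (Nat.prime_iff_prime_int.mp hp)
    (hh.pow_mul_coeff hj.ne').symm ?_)
  rw [← coeff_reduceMod_eq_zero_iff]
  exact leadingCoeff_ne_zero.mpr hh.reduceMod_ne_zero

theorem le_natDegree_reduceMod (hh : IsLocalExpansion p ξ σ f h) (hp : p.Prime)
    (hf : 0 < (reduceMod p f).natDegree) : σ ≤ (reduceMod p f).natDegree := by
  refine le_of_pow_mul_eq_pow_mul (Nat.prime_iff_prime_int.mp hp) (hh.pow_mul_coeff hf.ne') ?_
  rw [← coeff_reduceMod_eq_zero_iff, reduceMod, map_taylor, coeff_taylor_natDegree]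
  exact leadingCoeff_ne_zero.mpr (ne_zero_of_natDegree_gt hf)

theorem pow_mul_coeff_reducedDerivative (hh : IsLocalExpansion p ξ σ f h) {τ τ' : ℕ} {F H : ℤ[X]}
    (hF : IsReducedDerivative p τ f F) (hH : IsReducedDerivative p τ' h H) (j : ℕ) :
    (p : ℤ) ^ (σ + τ') * H.coeff j = p ^ (τ + 1 + j) * (taylor ξ F).coeff j := by
  have hder := congrArg (fun g => (derivative g).coeff j) hh.taylor_comp_eq
  simp only [derivative_comp, derivative_taylor, hF.derivative_eq, hH.derivative_eq, taylor_mul,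
    taylor_C, mul_comp, C_comp, derivative_C_mul, derivative_X, mul_one, derivative_add,
    derivative_C, zero_add, coeff_C_mul, comp_C_mul_X_coeff] at hder
  rw [pow_add, mul_assoc, ← hder]
  ring

theorem natDegree_reducedDerivative_le [Fact p.Prime] (hh : IsLocalExpansion p ξ σ f h) {τ τ' : ℕ}
    {F H : ℤ[X]} (hF : IsReducedDerivative p τ f F) (hH : IsReducedDerivative p τ' h H) :
    (reduceMod p H).natDegree ≤ (reduceMod p F).rootMultiplicity (ξ : ZMod p) := by
  have hp := Nat.prime_iff_prime_int.mp (Fact.out : p.Prime)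
  set n := (reduceMod p F).rootMultiplicity (ξ : ZMod p) with hn
  set m := (reduceMod p H).natDegree
  have hFn : ¬ (p : ℤ) ∣ (taylor ξ F).coeff n := by
    rw [← coeff_reduceMod_eq_zero_iff, reduceMod, map_taylor, hn,
      rootMultiplicity_eq_natTrailingDegree, eq_intCast, ← taylor_apply]
    exact trailingCoeff_nonzero_iff_nonzero.mpr ((taylor_eq_zero _ _).not.mpr hF.reduceMod_ne_zero)
  have hHm : ¬ (p : ℤ) ∣ H.coeff m := by
    rw [← coeff_reduceMod_eq_zero_iff]
    exact leadingCoeff_ne_zero.mpr hH.reduceMod_ne_zero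
  have hle := le_of_pow_mul_eq_pow_mul hp (hh.pow_mul_coeff_reducedDerivative hF hH n) hFn
  have hge := le_of_pow_mul_eq_pow_mul hp (hh.pow_mul_coeff_reducedDerivative hF hH m).symm hHm
  omega

end IsLocalExpansion

end LocalExpansion

section PrimePower

variable {p : ℕ} {f F : ℤ[X]}

-- With increment `p ^ (l - τ - 1) * z` the quadratic Taylor term vanishes modulo `p ^ l`.
theorem modChar_eval_add_mul_pow {l τ : ℕ} (hp : p ≠ 0) (hl : 2 * τ + 2 ≤ l)
    (hF : derivative f = C ((p : ℤ) ^ τ) * F) (x : ℤ) (z : ℕ) :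
    modChar (p ^ l) (f.eval (x + p ^ (l - τ - 1) * z)) =
      modChar (p ^ l) (f.eval x) * modChar p (F.eval x) ^ z := by
  obtain ⟨c, hc⟩ := f.binomExpansion x ((p : ℤ) ^ (l - τ - 1) * z)
  have hlinear : (p : ℤ) ^ (l - 1) = p ^ τ * p ^ (l - τ - 1) := by
    rw [← pow_add]; congr 1; omega
  have hsquare : ((p : ℤ) ^ (l - τ - 1) * z) ^ 2 = p ^ l * (p ^ (l - 2 * τ - 2) * z ^ 2) := by
    rw [mul_pow, ← mul_assoc, ← pow_add, ← pow_mul]; congr 2; omega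
  have hl' : p ^ l = p ^ (l - 1) * p := by rw [← pow_succ]; congr 1; omega
  rw [← modChar_natCast_mul, ← modChar_mul_mul_left (pow_ne_zero (l - 1) hp) p, ← hl',
    ← AddChar.map_add_eq_mul]
  refine modChar_congr (Int.modEq_iff_dvd.mpr ?_)
  push_cast
  rw [hc, hF, hlinear, hsquare, eval_mul, eval_C]
  exact ⟨-(c * (p ^ (l - 2 * τ - 2) * z ^ 2)), by ring⟩

theorem sum_modChar_eval_eq_zero_of_not_dvd {l τ : ℕ} (hp : p ≠ 0) (hl : 2 * τ + 2 ≤ l)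
    (hF : derivative f = C ((p : ℤ) ^ τ) * F) {x : ℤ} (hx : ¬ (p : ℤ) ∣ F.eval x) :
    ∑ z ∈ Finset.range (p ^ (τ + 1)), modChar (p ^ l) (f.eval (x + p ^ (l - τ - 1) * z)) = 0 := by
  have hne : modChar p (F.eval x) ≠ 1 := (modChar_eq_one_iff hp _).not.mpr hx
  have hone : modChar p (F.eval x) ^ p ^ (τ + 1) = 1 := by
    rw [← modChar_natCast_mul, modChar_eq_one_iff hp]
    exact Dvd.dvd.mul_right (by exact_mod_cast dvd_pow_self p τ.succ_ne_zero) _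
  simp only [modChar_eval_add_mul_pow hp hl hF]
  rw [← Finset.mul_sum, geom_sum_eq hne, hone, sub_self, zero_div, mul_zero]

theorem dvd_eval_add_mul_iff (F : ℤ[X]) (x y : ℤ) :
    (p : ℤ) ∣ F.eval (x + p * y) ↔ (p : ℤ) ∣ F.eval x :=
  dvd_iff_dvd_of_dvd_sub <| (Dvd.intro y (by ring)).trans (F.sub_dvd_eval_sub (x + p * y) x)

theorem sum_residueClass_eq_zero_of_not_dvd {l τ : ℕ} (hp : p ≠ 0) (hl : 2 * τ + 2 ≤ l)
    (hF : derivative f = C ((p : ℤ) ^ τ) * F) {ξ : ℤ} (hξ : ¬ (p : ℤ) ∣ F.eval ξ) :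
    ∑ y ∈ Finset.range (p ^ (l - 1)), modChar (p ^ l) (f.eval (ξ + p * (y : ℤ))) = 0 := by
  have hsplit : p ^ (l - 1) = p ^ (l - τ - 2) * p ^ (τ + 1) := by
    rw [← pow_add]; congr 1; omega
  have hpow : p ^ (l - τ - 1) = p * p ^ (l - τ - 2) := by
    rw [← pow_succ']; congr 1; omega
  rw [hsplit, sum_range_mul]
  refine Finset.sum_eq_zero fun y _ => ?_
  rw [← sum_modChar_eval_eq_zero_of_not_dvd hp hl hF (x := ξ + p * y)
    ((dvd_eval_add_mul_iff F ξ y).not.mpr hξ)]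
  refine Finset.sum_congr rfl fun z _ => ?_
  congr 2
  zify at hpow
  rw [hpow]
  push_cast
  ring

theorem completeExpSum_prime_pow_eq_sum_residueRoots {l τ : ℕ} (hp : p ≠ 0) (hl : 2 * τ + 2 ≤ l)
    (hF : derivative f = C ((p : ℤ) ^ τ) * F) :
    completeExpSum (p ^ l) f = ∑ ξ ∈ residueRoots p F,
      ∑ y ∈ Finset.range (p ^ (l - 1)), modChar (p ^ l) (f.eval ((ξ : ℤ) + p * (y : ℤ))) := by
  have hpow : p ^ l = p * p ^ (l - 1) := by rw [← pow_succ']; congr 1; omega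
  rw [completeExpSum, residueRoots, Finset.sum_filter]
  conv_lhs => rw [show Finset.range (p ^ l) = Finset.range (p * p ^ (l - 1)) by rw [← hpow]]
  rw [sum_range_mul]
  refine Finset.sum_congr rfl fun ξ _ => ?_
  push_cast
  split_ifs with hξ
  · rfl
  · exact sum_residueClass_eq_zero_of_not_dvd hp hl hF hξ

theorem IsLocalExpansion.sum_residueClass_eq {ξ : ℤ} {σ l : ℕ} {h : ℤ[X]}
    (hh : IsLocalExpansion p ξ σ f h) (hp : p.Prime) (hσ : σ ≤ l) :
    ∑ y ∈ Finset.range (p ^ (l - 1)), modChar (p ^ l) (f.eval (ξ + p * (y : ℤ))) =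
      modChar (p ^ l) (f.eval ξ) * (p ^ (σ - 1) * completeExpSum (p ^ (l - σ)) h) := by
  have hσ0 := hh.pos hp
  have hrange : p ^ (l - 1) = p ^ (l - σ) * p ^ (σ - 1) := by rw [← pow_add]; congr 1; omega
  have hmod : p ^ l = p ^ σ * p ^ (l - σ) := by rw [← pow_add]; congr 1; omega
  have hterm (y : ℕ) : modChar (p ^ l) (f.eval (ξ + p * (y : ℤ))) =
      modChar (p ^ l) (f.eval ξ) * modChar (p ^ (l - σ)) (h.eval (y : ℤ)) := by
    rw [hh.eval_add_mul, AddChar.map_add_eq_mul, ← modChar_mul_mul_left (pow_ne_zero σ hp.ne_zero)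
      (p ^ (l - σ)), ← hmod]
    push_cast
    rfl
  simp only [hterm]
  rw [← Finset.mul_sum, hrange, sum_range_mul_of_periodic (periodic_modChar_eval _ h),
    nsmul_eq_mul, completeExpSum]
  push_cast
  rfl

theorem pow_pred_le_rpow {x : ℝ} (hx : 1 ≤ x) {n k : ℕ} (hn : 0 < n) (hnk : n ≤ k) :
    x ^ (n - 1) ≤ (x ^ n) ^ (1 - 1 / (k : ℝ)) := by
  have hk : (0 : ℝ) < k := Nat.cast_pos.mpr (hn.trans_le hnk)
  have hdiv : (n : ℝ) * (1 / k) ≤ 1 := by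
    rw [mul_one_div, div_le_one hk]; exact Nat.cast_le.mpr hnk
  rw [← Real.rpow_natCast, ← Real.rpow_natCast, ← Real.rpow_mul (by linarith)]
  refine Real.rpow_le_rpow_of_exponent_le hx ?_
  rw [Nat.cast_pred hn]
  linarith

theorem IsLocalExpansion.norm_sum_residueClass_le {ξ : ℤ} {σ l k : ℕ} {h : ℤ[X]} {B : ℝ}
    (hh : IsLocalExpansion p ξ σ f h) (hp : p.Prime) (hl : 0 < l) (hσ : σ ≤ k) (hB : 1 ≤ B)
    (hsum : σ < l →
      ‖completeExpSum (p ^ (l - σ)) h‖ ≤ B * ((p ^ (l - σ) : ℕ) : ℝ) ^ (1 - 1 / (k : ℝ))) :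
    ‖∑ y ∈ Finset.range (p ^ (l - 1)), modChar (p ^ l) (f.eval (ξ + p * (y : ℤ)))‖ ≤
      B * ((p ^ l : ℕ) : ℝ) ^ (1 - 1 / (k : ℝ)) := by
  have hp1 : (1 : ℝ) ≤ p := Nat.one_le_cast.mpr hp.pos
  rcases lt_or_ge σ l with hσl | hlσ
  · have hmod : (p : ℝ) ^ l = p ^ σ * p ^ (l - σ) := by rw [← pow_add]; congr 1; omega
    rw [hh.sum_residueClass_eq hp hσl.le, norm_mul, norm_modChar, one_mul, norm_mul, norm_pow,
      Complex.norm_natCast]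
    calc (p : ℝ) ^ (σ - 1) * ‖completeExpSum (p ^ (l - σ)) h‖
        ≤ ((p : ℝ) ^ σ) ^ (1 - 1 / (k : ℝ)) *
            (B * ((p ^ (l - σ) : ℕ) : ℝ) ^ (1 - 1 / (k : ℝ))) := by
          gcongr
          exacts [pow_pred_le_rpow hp1 (hh.pos hp) hσ, hsum hσl]
      _ = B * ((p ^ l : ℕ) : ℝ) ^ (1 - 1 / (k : ℝ)) := by
          push_cast
          rw [hmod, Real.mul_rpow (by positivity) (by positivity)]
          ring
  · calc _ ≤ ((p ^ (l - 1) : ℕ) : ℝ) := by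
          simpa using norm_sum_modChar_le (Finset.range (p ^ (l - 1))) (p ^ l)
            fun y => f.eval (ξ + p * (y : ℤ))
      _ ≤ ((p ^ l : ℕ) : ℝ) ^ (1 - 1 / (k : ℝ)) := by
          push_cast
          exact pow_pred_le_rpow hp1 hl (hlσ.trans hσ)
      _ ≤ B * ((p ^ l : ℕ) : ℝ) ^ (1 - 1 / (k : ℝ)) := le_mul_of_one_le_left (by positivity) hB

theorem one_le_primePowConst {k : ℕ} (hk : 0 < k) : 1 ≤ primePowConst k := by
  have : (1 : ℝ) ≤ (k : ℝ) ^ 3 := one_le_pow₀ (Nat.one_le_cast.mpr hk)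
  exact this.trans (le_add_of_nonneg_left (by positivity))

theorem pow_le_pow_three_of_isReducedDerivative {τ l k : ℕ} (hp : p.Prime)
    (hF : IsReducedDerivative p τ f F) (hf : 0 < (reduceMod p f).natDegree)
    (hfk : f.natDegree ≤ k) (hl : 1 < l) (hlτ : l < 2 * τ + 2) : p ^ l ≤ k ^ 3 := by
  have hτ : p ^ τ ≤ k := (Nat.le_of_dvd hf (hF.pow_dvd_natDegree_reduceMod hp hf)).trans
    (natDegree_map_le.trans hfk)
  calc p ^ l ≤ p ^ (τ * 3) := Nat.pow_le_pow_right hp.pos (by omega)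
    _ = (p ^ τ) ^ 3 := pow_mul _ _ _
    _ ≤ k ^ 3 := by gcongr

theorem norm_completeExpSum_prime_pow_le_of_lt [Fact p.Prime] {τ l k : ℕ}
    (hF : IsReducedDerivative p τ f F) (hf : 0 < (reduceMod p f).natDegree)
    (hfk : f.natDegree ≤ k) (hl : 0 < l) (hlτ : l = 1 ∨ l < 2 * τ + 2) :
    ‖completeExpSum (p ^ l) f‖ ≤ primePowConst k * ((p ^ l : ℕ) : ℝ) ^ (1 - 1 / (k : ℝ)) := by
  have hp := (Fact.out : p.Prime)
  by_cases hl1 : l = 1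
  · rw [hl1, pow_one]
    exact norm_completeExpSum_prime_le hfk hf
  · exact norm_completeExpSum_le_of_le_pow_three (pow_pos hp.pos l)
      ((natDegree_pos_of_reduceMod hf).trans_le hfk)
      (pow_le_pow_three_of_isReducedDerivative hp hF hf hfk (by omega) (by omega)) f

theorem norm_completeExpSum_prime_pow_le_mul_max {k l : ℕ} [Fact p.Prime] (hl : 0 < l) {τ : ℕ}
    (hfk : f.natDegree ≤ k) (hf : 0 < (reduceMod p f).natDegree)
    (hF : IsReducedDerivative p τ f F) :
    ‖completeExpSum (p ^ l) f‖ ≤ primePowConst k * (max 1 (reduceMod p F).natDegree : ℕ) *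
      ((p ^ l : ℕ) : ℝ) ^ (1 - 1 / (k : ℝ)) := by
  have hp := (Fact.out : p.Prime)
  induction l using Nat.strong_induction_on generalizing f F τ with
  | _ l ih =>
  have hA := one_le_primePowConst ((natDegree_pos_of_reduceMod hf).trans_le hfk)
  have mono {n : ℕ} (hn : 1 ≤ n) : primePowConst k ≤ primePowConst k * n :=
    le_mul_of_one_le_right (by linarith) (Nat.one_le_cast.mpr hn)
  by_cases hlτ : l = 1 ∨ l < 2 * τ + 2
  · refine (norm_completeExpSum_prime_pow_le_of_lt hF hf hfk hl hlτ).trans ?_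
    gcongr
    exact mono (le_max_left _ _)
  have hclass : ∀ ξ ∈ residueRoots p F,
      ‖∑ y ∈ Finset.range (p ^ (l - 1)), modChar (p ^ l) (f.eval ((ξ : ℤ) + p * (y : ℤ)))‖ ≤
        primePowConst k * ((reduceMod p F).rootMultiplicity (ξ : ZMod p) : ℕ) *
          ((p ^ l : ℕ) : ℝ) ^ (1 - 1 / (k : ℝ)) := by
    intro ξ hξ
    have hmult : 1 ≤ (reduceMod p F).rootMultiplicity (ξ : ZMod p) :=
      (rootMultiplicity_pos hF.reduceMod_ne_zero).mpr <| by
        simpa using (intCast_dvd_eval_iff_isRoot F ξ).mp (Finset.mem_filter.mp hξ).2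
    obtain ⟨σ, h, hh⟩ := exists_isLocalExpansion hp (natDegree_pos_of_reduceMod hf) ξ
    have hhdeg := hh.natDegree_reduceMod_pos hp.ne_zero
    obtain ⟨τ', H, hH⟩ := exists_isReducedDerivative hp (natDegree_pos_of_reduceMod hhdeg)
    have hHdeg := hh.natDegree_reducedDerivative_le hF hH
    rw [Int.cast_natCast] at hHdeg
    refine hh.norm_sum_residueClass_le hp hl
      ((hh.le_natDegree_reduceMod hp hf).trans (natDegree_map_le.trans hfk))
      (hA.trans (mono hmult)) fun hσ => ?_
    refine (ih (l - σ) (Nat.sub_lt hl (hh.pos hp)) (Nat.sub_pos_of_lt hσ)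
      ((hh.natDegree_le hp.ne_zero).trans hfk) hhdeg hH).trans ?_
    gcongr
    exact max_le hmult hHdeg
  rw [completeExpSum_prime_pow_eq_sum_residueRoots hp.ne_zero (by omega) hF.derivative_eq]
  refine (norm_sum_le _ _).trans ((Finset.sum_le_sum hclass).trans ?_)
  rw [← Finset.sum_mul, ← Finset.mul_sum, ← Nat.cast_sum]
  gcongr
  exact (sum_rootMultiplicity_residueRoots_le F).trans (le_max_right _ _)

theorem norm_completeExpSum_prime_pow_le [Fact p.Prime] {k l : ℕ} (hl : 0 < l)
    (hfk : f.natDegree ≤ k) (hf : 0 < (reduceMod p f).natDegree) :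
    ‖completeExpSum (p ^ l) f‖ ≤
      primePowConst k * k * ((p ^ l : ℕ) : ℝ) ^ (1 - 1 / (k : ℝ)) := by
  have hp := (Fact.out : p.Prime)
  have hfdeg := natDegree_pos_of_reduceMod hf
  have hA := one_le_primePowConst (hfdeg.trans_le hfk)
  obtain ⟨τ, F, hF⟩ := exists_isReducedDerivative hp hfdeg
  refine (norm_completeExpSum_prime_pow_le_mul_max hl hfk hf hF).trans ?_
  have hFk := hF.natDegree_reduceMod_le hp.ne_zero
  gcongr
  omega

end PrimePower

section Multiplicativity

theorem sum_range_mul_of_coprime {R : Type*} [NonUnitalNonAssocSemiring R] {a b : ℕ} [NeZero a]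
    [NeZero b] (hab : a.Coprime b) (g : ZMod a → R) (h : ZMod b → R) :
    ∑ x ∈ Finset.range (a * b), g x * h x = (∑ x, g x) * ∑ x, h x := by
  have hcrt := sum_range_natCast_zmod (q := a * b) fun x =>
    g (ZMod.chineseRemainder hab x).1 * h (ZMod.chineseRemainder hab x).2
  simp only [map_natCast, Prod.fst_natCast, Prod.snd_natCast] at hcrt
  rw [hcrt, Fintype.sum_mul_sum, ← Fintype.sum_prod_type']
  exact Fintype.sum_equiv (ZMod.chineseRemainder hab).toEquiv _ _ fun x => rfl

theorem completeExpSum_mul_of_coprime {a b : ℕ} (ha : a ≠ 0) (hb : b ≠ 0) {u v : ℤ}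
    (huv : u * b + v * a = 1) (f : ℤ[X]) :
    completeExpSum (a * b) f = completeExpSum a (C u * f) * completeExpSum b (C v * f) := by
  have : NeZero a := ⟨ha⟩
  have : NeZero b := ⟨hb⟩
  have hab : a.Coprime b := Nat.isCoprime_iff_coprime.mp ⟨v, u, by linarith⟩
  rw [completeExpSum_eq_sum_zmod a, completeExpSum_eq_sum_zmod b, ← sum_range_mul_of_coprime hab,
    completeExpSum]
  refine Finset.sum_congr rfl fun x _ => ?_
  rw [← Int.cast_natCast (R := ZMod a), ← Int.cast_natCast (R := ZMod b), eval_reduceMod,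
    eval_reduceMod, ← modChar_eq_stdAddChar, ← modChar_eq_stdAddChar,
    ← modChar_mul_mul_left hb a, ← modChar_mul_mul_left ha b, mul_comm b a,
    ← AddChar.map_add_eq_mul, eval_C_mul, eval_C_mul]
  congr 1
  linear_combination (-f.eval (x : ℤ)) * huv

/-- `f` is nonconstant modulo every prime factor of `q`: the nondegeneracy condition under which
the complete exponential sum of `f` modulo `q` is small. -/
def NonconstantModPrimeFactors (q : ℕ) (f : ℤ[X]) : Prop :=
  ∀ p : ℕ, p.Prime → p ∣ q → 0 < (reduceMod p f).natDegree

theorem NonconstantModPrimeFactors.C_mul {q r : ℕ} {f : ℤ[X]}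
    (hf : NonconstantModPrimeFactors q f) (hrq : r ∣ q) {u : ℤ} (hu : IsCoprime u r) :
    NonconstantModPrimeFactors r (C u * f) := by
  intro p hp hpr
  have : Fact p.Prime := ⟨hp⟩
  have hpu : (Int.castRingHom (ZMod p)) u ≠ 0 := by
    rw [eq_intCast, Ne, ZMod.intCast_zmod_eq_zero_iff_dvd]
    exact fun hpu => (Nat.prime_iff_prime_int.mp hp).not_isUnit <|
      hu.isUnit_of_dvd' hpu (Int.natCast_dvd_natCast.mpr hpr)
  rw [reduceMod, Polynomial.map_mul, map_C, natDegree_C_mul hpu]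
  exact hf p hp (hpr.trans hrq)

theorem norm_completeExpSum_le_pow_card_primeFactors {k q : ℕ} (hq : 0 < q) {f : ℤ[X]}
    (hfk : f.natDegree ≤ k) (hf : NonconstantModPrimeFactors q f) :
    ‖completeExpSum q f‖ ≤ (primePowConst k * k) ^ q.primeFactors.card *
      (q : ℝ) ^ (1 - 1 / (k : ℝ)) := by
  induction q using Nat.recOnPosPrimePosCoprime generalizing f with
  | zero => exact absurd hq (lt_irrefl 0)
  | one => simpa using norm_completeExpSum_le 1 f
  | prime_pow p n hp hn =>
    have : Fact p.Prime := ⟨hp⟩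
    rw [Nat.primeFactors_prime_pow hn.ne' hp, Finset.card_singleton, pow_one]
    exact norm_completeExpSum_prime_pow_le hn hfk (hf p hp (dvd_pow_self p hn.ne'))
  | coprime a b ha hb hab iha ihb =>
    obtain ⟨v, u, huv⟩ := Nat.isCoprime_iff_coprime.mpr hab
    have ha' := iha (by omega) ((natDegree_C_mul_le u f).trans hfk)
      (hf.C_mul (dvd_mul_right a b) ⟨b, v, by linarith⟩)
    have hb' := ihb (by omega) ((natDegree_C_mul_le v f).trans hfk)
      (hf.C_mul (dvd_mul_left b a) ⟨a, u, by linarith⟩)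
    rw [completeExpSum_mul_of_coprime (by omega) (by omega) (by linarith : u * b + v * a = 1),
      norm_mul, hab.primeFactors_mul, Finset.card_union_of_disjoint hab.disjoint_primeFactors,
      pow_add, Nat.cast_mul, Real.mul_rpow (by positivity) (by positivity), mul_mul_mul_comm]
    exact mul_le_mul ha' hb' (norm_nonneg _) ((norm_nonneg _).trans ha')

theorem le_ite_mul_rpow {A ε p : ℝ} {M : ℕ} (hA : 1 ≤ A) (hε : 0 < ε) (hp : 1 ≤ p)
    (hM : A ^ (1 / ε) ≤ M) : A ≤ (if p < M then A else 1) * p ^ ε := by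
  split_ifs with h
  · exact le_mul_of_one_le_right (by linarith) (Real.one_le_rpow hp hε.le)
  · calc A = (A ^ (1 / ε)) ^ ε := by
          rw [← Real.rpow_mul (by linarith), one_div_mul_cancel hε.ne', Real.rpow_one]
      _ ≤ p ^ ε := Real.rpow_le_rpow (by positivity) (hM.trans (not_lt.mp h)) hε.le
      _ = 1 * p ^ ε := (one_mul _).symm

theorem exists_pow_card_primeFactors_le {A ε : ℝ} (hA : 1 ≤ A) (hε : 0 < ε) :
    ∃ K : ℝ, 0 < K ∧ ∀ q : ℕ, 0 < q → A ^ q.primeFactors.card ≤ K * (q : ℝ) ^ ε := by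
  obtain ⟨M, hM⟩ := exists_nat_ge (A ^ (1 / ε))
  refine ⟨A ^ M, by positivity, fun q hq => ?_⟩
  have hsmall : (q.primeFactors.filter fun p : ℕ => (p : ℝ) < M).card ≤ M :=
    (Finset.card_le_card fun p hp => by simpa using (Finset.mem_filter.mp hp).2).trans
      (Finset.card_range M).le
  have hrad : ∏ p ∈ q.primeFactors, p ≤ q := Nat.le_of_dvd hq (Nat.prod_primeFactors_dvd q)
  calc A ^ q.primeFactors.card
      = ∏ _p ∈ q.primeFactors, A := by rw [Finset.prod_const]
    _ ≤ ∏ p ∈ q.primeFactors, (if (p : ℝ) < M then A else 1) * (p : ℝ) ^ ε :=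
        Finset.prod_le_prod (fun _ _ => by linarith) fun p hp => le_ite_mul_rpow hA hε
          (Nat.one_le_cast.mpr (Nat.prime_of_mem_primeFactors hp).pos) hM
    _ = A ^ (q.primeFactors.filter fun p : ℕ => (p : ℝ) < M).card *
          ((∏ p ∈ q.primeFactors, p : ℕ) : ℝ) ^ ε := by
        rw [Finset.prod_mul_distrib, Real.finsetProd_rpow _ _ (fun _ _ => by positivity),
          Finset.prod_ite]
        simp
    _ ≤ A ^ M * (q : ℝ) ^ ε := by gcongr

theorem exists_norm_completeExpSum_le {k : ℕ} (hk : 0 < k) {ε : ℝ} (hε : 0 < ε) :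
    ∃ K : ℝ, 0 < K ∧ ∀ (q : ℕ) (f : ℤ[X]), 0 < q → f.natDegree ≤ k →
      NonconstantModPrimeFactors q f →
      ‖completeExpSum q f‖ ≤ K * (q : ℝ) ^ (1 - 1 / (k : ℝ) + ε) := by
  have hA : 1 ≤ primePowConst k * k :=
    one_le_mul_of_one_le_of_one_le (one_le_primePowConst hk) (Nat.one_le_cast.mpr hk)
  obtain ⟨K, hK, hω⟩ := exists_pow_card_primeFactors_le hA hε
  refine ⟨K, hK, fun q f hq hfk hf => ?_⟩
  calc ‖completeExpSum q f‖
      ≤ (primePowConst k * k) ^ q.primeFactors.card * (q : ℝ) ^ (1 - 1 / (k : ℝ)) :=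
        norm_completeExpSum_le_pow_card_primeFactors hq hfk hf
    _ ≤ K * (q : ℝ) ^ ε * (q : ℝ) ^ (1 - 1 / (k : ℝ)) := by gcongr; exact hω q hq
    _ = K * (q : ℝ) ^ (1 - 1 / (k : ℝ) + ε) := by
        rw [add_comm _ ε, Real.rpow_add (Nat.cast_pos.mpr hq), mul_assoc]

end Multiplicativity

section Divisors

theorem natCast_add_one_le_mul_one_add_pow {x : ℝ} (hx : 0 < x) (n : ℕ) :
    (n : ℝ) + 1 ≤ (1 + 1 / x) * (1 + x) ^ n := by
  calc (n : ℝ) + 1 ≤ n + 1 + 1 / x + n * x := by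
        have : 0 ≤ 1 / x + n * x := by positivity
        linarith
    _ = (1 + 1 / x) * (1 + n * x) := by field_simp; ring
    _ ≤ (1 + 1 / x) * (1 + x) ^ n := by
        gcongr
        exact one_add_mul_le_pow (by linarith) n

theorem card_divisors_le_pow_card_primeFactors_mul_rpow {ε : ℝ} (hε : 0 < ε) {q : ℕ} (hq : 0 < q) :
    (q.divisors.card : ℝ) ≤
      (1 + 1 / ((2 : ℝ) ^ ε - 1)) ^ q.primeFactors.card * (q : ℝ) ^ ε := by
  have hx : 0 < (2 : ℝ) ^ ε - 1 := sub_pos.mpr (Real.one_lt_rpow one_lt_two hε)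
  induction q using Nat.recOnPosPrimePosCoprime with
  | zero => exact absurd hq (lt_irrefl 0)
  | one => simp
  | prime_pow p n hp hn =>
    have h2p : (2 : ℝ) ≤ p := Nat.ofNat_le_cast.mpr hp.two_le
    rw [Nat.primeFactors_prime_pow hn.ne' hp, Finset.card_singleton, pow_one,
      Nat.divisors_prime_pow hp, Finset.card_map, Finset.card_range, Nat.cast_pow,
      ← Real.rpow_pow_comm p.cast_nonneg]
    calc ((n + 1 : ℕ) : ℝ)
        ≤ (1 + 1 / ((2 : ℝ) ^ ε - 1)) * (1 + ((2 : ℝ) ^ ε - 1)) ^ n := by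
          push_cast
          exact natCast_add_one_le_mul_one_add_pow hx n
      _ ≤ (1 + 1 / ((2 : ℝ) ^ ε - 1)) * ((p : ℝ) ^ ε) ^ n := by
          rw [add_sub_cancel]
          gcongr
  | coprime a b ha hb hab iha ihb =>
    rw [hab.card_divisors_mul, hab.primeFactors_mul,
      Finset.card_union_of_disjoint hab.disjoint_primeFactors, pow_add, Nat.cast_mul, Nat.cast_mul,
      Real.mul_rpow (by positivity) (by positivity), mul_mul_mul_comm]
    exact mul_le_mul (iha (by omega)) (ihb (by omega)) (by positivity) (by positivity)

theorem exists_card_divisors_le {ε : ℝ} (hε : 0 < ε) :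
    ∃ K : ℝ, 0 < K ∧ ∀ q : ℕ, 0 < q → (q.divisors.card : ℝ) ≤ K * (q : ℝ) ^ ε := by
  have hx : 0 < (2 : ℝ) ^ (ε / 2) - 1 := sub_pos.mpr (Real.one_lt_rpow one_lt_two (by linarith))
  obtain ⟨K, hK, hω⟩ := exists_pow_card_primeFactors_le
    (le_add_of_nonneg_right (one_div_pos.mpr hx).le) (half_pos hε)
  refine ⟨K, hK, fun q hq => ?_⟩
  calc (q.divisors.card : ℝ)
      ≤ (1 + 1 / ((2 : ℝ) ^ (ε / 2) - 1)) ^ q.primeFactors.card * (q : ℝ) ^ (ε / 2) :=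
        card_divisors_le_pow_card_primeFactors_mul_rpow (half_pos hε) hq
    _ ≤ K * (q : ℝ) ^ (ε / 2) * (q : ℝ) ^ (ε / 2) := by gcongr; exact hω q hq
    _ = K * (q : ℝ) ^ ε := by
        rw [mul_assoc, ← Real.rpow_add (Nat.cast_pos.mpr hq), add_halves]

end Divisors

section FourierCompletion

theorem two_mul_mul_one_sub_le_sin_pi_mul {t : ℝ} (h0 : 0 ≤ t) (h1 : t ≤ 1) :
    2 * t * (1 - t) ≤ Real.sin (Real.pi * t) := by
  have hpi := Real.pi_pos
  have hhalf {s : ℝ} (hs0 : 0 ≤ s) (hs : s ≤ 1 / 2) : 2 * s ≤ Real.sin (Real.pi * s) :=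
    calc 2 * s = 2 / Real.pi * (Real.pi * s) := by field_simp
      _ ≤ Real.sin (Real.pi * s) := Real.mul_le_sin (by positivity) (by nlinarith)
  rcases le_total t (1 / 2) with ht | ht
  · nlinarith [hhalf h0 ht]
  · have hsymm : Real.sin (Real.pi * t) = Real.sin (Real.pi * (1 - t)) := by
      rw [← Real.sin_pi_sub]; ring_nf
    nlinarith [hhalf (sub_nonneg.mpr h1) (by linarith)]

theorem norm_modChar_sub_one (q : ℕ) (a : ℤ) :
    ‖modChar q a - 1‖ = 2 * |Real.sin (Real.pi * (a / q))| := by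
  have hexp : modChar q a = Complex.exp (Complex.I * ((2 * (Real.pi * (a / q)) : ℝ) : ℂ)) := by
    rw [modChar_apply]; push_cast; ring_nf
  rw [hexp, Complex.norm_exp_I_mul_ofReal_sub_one, mul_div_cancel_left₀ _ two_ne_zero, norm_mul,
    Real.norm_ofNat, Real.norm_eq_abs]

theorem modChar_neg (q : ℕ) (a : ℤ) : modChar q (-a) = starRingEnd ℂ (modChar q a) := by
  rw [AddChar.map_neg_eq_inv, Complex.inv_eq_conj (norm_modChar q a)]

theorem norm_sum_Ico_modChar_mul_neg_le {q k : ℕ} (hk : 0 < k) (hkq : k < q) {A B : ℕ}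
    (hAB : A ≤ B) :
    ‖∑ a ∈ Finset.Ico A B, modChar q (a * -(k : ℤ))‖ ≤
      q * (1 / 2 * (1 / (k : ℝ) + 1 / ((q - k : ℕ) : ℝ))) := by
  have hkR : (0 : ℝ) < k := Nat.cast_pos.mpr hk
  have hkqR : (k : ℝ) < q := Nat.cast_lt.mpr hkq
  have hqR : (0 : ℝ) < q := hkR.trans hkqR
  have hqk : (0 : ℝ) < q - k := sub_pos.mpr hkqR
  have hne : modChar q (-(k : ℤ)) ≠ 1 := by
    rw [Ne, modChar_eq_one_iff (by omega), dvd_neg, Int.natCast_dvd_natCast]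
    exact Nat.not_dvd_of_pos_of_lt hk hkq
  have hsin : 2 * (k / q : ℝ) * (1 - k / q) ≤ |Real.sin (Real.pi * (k / q))| :=
    (two_mul_mul_one_sub_le_sin_pi_mul (by positivity) (div_le_one hqR |>.mpr hkqR.le)).trans
      (le_abs_self _)
  have hnum : ‖modChar q (-(k : ℤ)) ^ B - modChar q (-(k : ℤ)) ^ A‖ ≤ 2 := by
    refine (norm_sub_le _ _).trans ?_
    simp only [norm_pow, norm_modChar, one_pow]
    norm_num
  have hden : ‖modChar q (-(k : ℤ)) - 1‖ = 2 * |Real.sin (Real.pi * (k / q))| := by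
    rw [norm_modChar_sub_one, Int.cast_neg, Int.cast_natCast, neg_div, mul_neg, Real.sin_neg,
      abs_neg]
  have hpos : 0 < 2 * (k / q : ℝ) * (1 - k / q) := by
    have : (k / q : ℝ) < 1 := (div_lt_one hqR).mpr hkqR
    have : (0 : ℝ) < k / q := by positivity
    nlinarith
  simp only [modChar_natCast_mul]
  rw [geom_sum_Ico hne hAB, norm_div, hden, Nat.cast_sub hkq.le]
  calc _ ≤ 2 / (2 * (2 * (k / q : ℝ) * (1 - k / q))) := by gcongr
    _ = q * (1 / 2 * (1 / (k : ℝ) + 1 / (q - k))) := by field_simp; ring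

theorem sum_range_modChar_mul {q : ℕ} (hq : q ≠ 0) (m : ℤ) :
    ∑ k ∈ Finset.range q, modChar q (k * m) = if (q : ℤ) ∣ m then (q : ℂ) else 0 := by
  simp only [modChar_natCast_mul]
  split_ifs with hm
  · simp [(modChar_eq_one_iff hq m).mpr hm]
  · rw [geom_sum_eq ((modChar_eq_one_iff hq m).not.mpr hm), ← modChar_natCast_mul,
      (modChar_eq_one_iff hq _).mpr (dvd_mul_right _ _), sub_self, zero_div]

theorem sum_Ico_ite_dvd_sub {q A B : ℕ} (hB : B ≤ q) (y : ℤ) (c : ℂ) :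
    ∑ a ∈ Finset.Ico A B, (if (q : ℤ) ∣ y - a then c else 0) =
      if (A : ℤ) ≤ y % q ∧ y % q < B then c else 0 := by
  rcases q.eq_zero_or_pos with rfl | hq
  · obtain rfl : B = 0 := by omega
    simp only [zero_le, Finset.Ico_eq_empty_of_le, Finset.sum_empty]
    rw [if_neg (by omega)]
  have hy0 := Int.emod_nonneg y (Int.natCast_ne_zero.mpr hq.ne')
  have hiff {a : ℕ} (ha : a ∈ Finset.Ico A B) : (q : ℤ) ∣ y - a ↔ (y % q).toNat = a := by
    have haq : (a : ℤ) % q = a := by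
      have := Finset.mem_Ico.mp ha
      exact Int.emod_eq_of_lt (by omega) (by omega)
    rw [Int.dvd_iff_emod_eq_zero, ← Int.emod_eq_emod_iff_emod_sub_eq_zero, haq]
    omega
  rw [Finset.sum_congr rfl fun a ha => by rw [if_congr (hiff ha) rfl rfl], Finset.sum_ite_eq]
  refine if_congr ?_ rfl rfl
  rw [Finset.mem_Ico]
  omega

variable {ι : Type*} (s : Finset ι) (y : ι → ℤ) {q A B : ℕ}

theorem natCast_mul_card_filter_emod_eq_sum (hq : q ≠ 0) (hB : B ≤ q) :
    (q : ℂ) * (s.filter fun i => (A : ℤ) ≤ y i % q ∧ y i % q < B).card =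
      ∑ k ∈ Finset.range q, (∑ a ∈ Finset.Ico A B, modChar q (a * -(k : ℤ))) *
        ∑ i ∈ s, modChar q (k * y i) := by
  calc (q : ℂ) * (s.filter fun i => (A : ℤ) ≤ y i % q ∧ y i % q < B).card
      = ∑ i ∈ s, if (A : ℤ) ≤ y i % q ∧ y i % q < B then (q : ℂ) else 0 := by
        rw [← Finset.sum_filter, Finset.sum_const, nsmul_eq_mul, mul_comm]
    _ = ∑ i ∈ s, ∑ a ∈ Finset.Ico A B, ∑ k ∈ Finset.range q, modChar q (k * (y i - a)) := by
        simp only [sum_range_modChar_mul hq, sum_Ico_ite_dvd_sub hB]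
    _ = ∑ k ∈ Finset.range q, ∑ i ∈ s, ∑ a ∈ Finset.Ico A B, modChar q (k * (y i - a)) :=
        (Finset.sum_congr rfl fun i _ => Finset.sum_comm).trans Finset.sum_comm
    _ = _ := by
        refine Finset.sum_congr rfl fun k _ => ?_
        rw [Finset.sum_mul_sum, Finset.sum_comm]
        simp only [← AddChar.map_add_eq_mul]
        refine Finset.sum_congr rfl fun a _ => Finset.sum_congr rfl fun i _ => ?_
        congr 1
        ring

theorem norm_sum_modChar_natSub_mul {k : ℕ} (hk : k ≤ q) :
    ‖∑ i ∈ s, modChar q ((q - k : ℕ) * y i)‖ = ‖∑ i ∈ s, modChar q (k * y i)‖ := by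
  rw [← Complex.norm_conj (∑ i ∈ s, modChar q (k * y i)), map_sum]
  simp only [← modChar_neg]
  congr 1
  refine Finset.sum_congr rfl fun i _ => modChar_congr (Int.modEq_iff_dvd.mpr ⟨-y i, ?_⟩)
  push_cast [hk]
  ring

theorem sum_Ico_half_reciprocals_mul {w : ℕ → ℝ} (hw : ∀ k < q, w (q - k) = w k) :
    ∑ k ∈ Finset.Ico 1 q, 1 / 2 * (1 / (k : ℝ) + 1 / ((q - k : ℕ) : ℝ)) * w k =
      ∑ k ∈ Finset.Ico 1 q, w k / k := by
  have hsymm : ∑ k ∈ Finset.Ico 1 q, w k / ((q - k : ℕ) : ℝ) = ∑ k ∈ Finset.Ico 1 q, w k / k := by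
    have hreflect := Finset.sum_Ico_reflect (fun k => w k / (k : ℝ)) 1 q.le_succ
    rw [Nat.add_sub_cancel_left, Nat.add_sub_cancel] at hreflect
    rw [← hreflect]
    exact Finset.sum_congr rfl fun k hk => by rw [hw k (Finset.mem_Ico.mp hk).2]
  calc _ = 1 / 2 * (∑ k ∈ Finset.Ico 1 q, w k / k +
          ∑ k ∈ Finset.Ico 1 q, w k / ((q - k : ℕ) : ℝ)) := by
        rw [← Finset.sum_add_distrib, Finset.mul_sum]
        exact Finset.sum_congr rfl fun k _ => by ring
    _ = _ := by rw [hsymm]; ring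

theorem abs_card_filter_emod_sub_le (hq : 0 < q) (hAB : A ≤ B) (hB : B ≤ q) :
    |((s.filter fun i => (A : ℤ) ≤ y i % q ∧ y i % q < B).card : ℝ) - s.card * (B - A) / q| ≤
      ∑ k ∈ Finset.Ico 1 q, ‖∑ i ∈ s, modChar q (k * y i)‖ / k := by
  have hqR : (0 : ℝ) < q := Nat.cast_pos.mpr hq
  have hexpand := natCast_mul_card_filter_emod_eq_sum s y (A := A) hq.ne' hB
  set N := (s.filter fun i => (A : ℤ) ≤ y i % q ∧ y i % q < B).card
  rw [Finset.range_eq_Ico, Finset.sum_eq_sum_Ico_succ_bot hq] at hexpand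
  have hmain : (q : ℂ) * ((N - s.card * (B - A) / q : ℝ) : ℂ) =
      ∑ k ∈ Finset.Ico 1 q, (∑ a ∈ Finset.Ico A B, modChar q (a * -(k : ℤ))) *
        ∑ i ∈ s, modChar q (k * y i) := by
    have hqC : (q : ℂ) ≠ 0 := Nat.cast_ne_zero.mpr hq.ne'
    simp only [Nat.cast_zero, neg_zero, mul_zero, zero_mul, AddChar.map_zero_eq_one,
      Finset.sum_const, Nat.card_Ico, nsmul_eq_mul, mul_one, Nat.cast_sub hAB] at hexpand
    push_cast
    rw [mul_sub, mul_div_cancel₀ _ hqC]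
    linear_combination hexpand
  refine le_of_mul_le_mul_left ?_ hqR
  calc (q : ℝ) * |(N : ℝ) - s.card * (B - A) / q|
      = ‖∑ k ∈ Finset.Ico 1 q, (∑ a ∈ Finset.Ico A B, modChar q (a * -(k : ℤ))) *
          ∑ i ∈ s, modChar q (k * y i)‖ := by
        rw [← hmain, norm_mul, Complex.norm_natCast, Complex.norm_real, Real.norm_eq_abs]
    _ ≤ ∑ k ∈ Finset.Ico 1 q, q * (1 / 2 * (1 / (k : ℝ) + 1 / ((q - k : ℕ) : ℝ)) *
          ‖∑ i ∈ s, modChar q (k * y i)‖) := by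
        refine (norm_sum_le _ _).trans (Finset.sum_le_sum fun k hk => ?_)
        have hk' := Finset.mem_Ico.mp hk
        rw [norm_mul, ← mul_assoc]
        gcongr
        exact norm_sum_Ico_modChar_mul_neg_le hk'.1 hk'.2 hAB
    _ = q * ∑ k ∈ Finset.Ico 1 q, ‖∑ i ∈ s, modChar q (k * y i)‖ / k := by
        rw [← Finset.mul_sum, sum_Ico_half_reciprocals_mul fun k hk =>
          norm_sum_modChar_natSub_mul s y hk.le]

end FourierCompletion

section ResidueCounts

theorem sum_Ico_filter_dvd_div_le {e : ℕ} (he : 0 < e) (q : ℕ) :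
    ∑ k ∈ Finset.Ico 1 q with e ∣ k, (e : ℝ) / k ≤ 1 + Real.log q := by
  have hsubset : (Finset.Ico 1 q).filter (e ∣ ·) ⊆ (Finset.Icc 1 q).image (e * ·) := by
    intro k hk
    obtain ⟨hkq, j, rfl⟩ := Finset.mem_filter.mp hk
    rw [Finset.mem_Ico] at hkq
    refine Finset.mem_image_of_mem _ (Finset.mem_Icc.mpr ⟨Nat.pos_of_mul_pos_left hkq.1, ?_⟩)
    exact (Nat.le_mul_of_pos_left j he).trans hkq.2.le
  calc ∑ k ∈ Finset.Ico 1 q with e ∣ k, (e : ℝ) / k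
      ≤ ∑ k ∈ (Finset.Icc 1 q).image (e * ·), (e : ℝ) / k :=
        Finset.sum_le_sum_of_subset_of_nonneg hsubset fun _ _ _ => by positivity
    _ = ∑ j ∈ Finset.Icc 1 q, (j : ℝ)⁻¹ := by
        rw [Finset.sum_image fun i _ j _ hij => Nat.eq_of_mul_eq_mul_left he hij]
        refine Finset.sum_congr rfl fun j _ => ?_
        rw [Nat.cast_mul, div_mul_cancel_left₀ (Nat.cast_ne_zero.mpr he.ne')]
    _ = harmonic q := by rw [harmonic_eq_sum_Icc]; push_cast; rfl
    _ ≤ 1 + Real.log q := harmonic_le_one_add_log q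

theorem sum_Ico_gcd_div_le (q : ℕ) :
    ∑ k ∈ Finset.Ico 1 q, (Nat.gcd k q : ℝ) / k ≤ q.divisors.card * (1 + Real.log q) := by
  have hgcd : ∀ k ∈ Finset.Ico 1 q,
      (Nat.gcd k q : ℝ) / k ≤ ∑ e ∈ q.divisors, if e ∣ k then (e : ℝ) / k else 0 := by
    intro k hk
    have hmem : Nat.gcd k q ∈ q.divisors :=
      Nat.mem_divisors.mpr ⟨Nat.gcd_dvd_right k q, by have := Finset.mem_Ico.mp hk; omega⟩
    refine le_of_eq_of_le ?_ (Finset.single_le_sum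
      (f := fun e : ℕ => if e ∣ k then (e : ℝ) / k else 0)
      (fun e _ => by split_ifs <;> positivity) hmem)
    rw [if_pos (Nat.gcd_dvd_left k q)]
  calc ∑ k ∈ Finset.Ico 1 q, (Nat.gcd k q : ℝ) / k
      ≤ ∑ k ∈ Finset.Ico 1 q, ∑ e ∈ q.divisors, if e ∣ k then (e : ℝ) / k else 0 :=
        Finset.sum_le_sum hgcd
    _ = ∑ e ∈ q.divisors, ∑ k ∈ Finset.Ico 1 q with e ∣ k, (e : ℝ) / k := by
        rw [Finset.sum_comm]
        simp only [Finset.sum_filter]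
    _ ≤ ∑ e ∈ q.divisors, (1 + Real.log q) := Finset.sum_le_sum fun e he =>
        sum_Ico_filter_dvd_div_le (Nat.pos_of_mem_divisors he) q
    _ = q.divisors.card * (1 + Real.log q) := by rw [Finset.sum_const, nsmul_eq_mul]

theorem one_add_log_le_mul_rpow {x ε : ℝ} (hx : 1 ≤ x) (hε : 0 < ε) :
    1 + Real.log x ≤ (1 + 1 / ε) * x ^ ε := by
  have hlog := Real.log_le_rpow_div (by linarith : 0 ≤ x) hε
  have hone := Real.one_le_rpow hx hε.le
  calc 1 + Real.log x ≤ x ^ ε + x ^ ε / ε := add_le_add hone hlog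
    _ = (1 + 1 / ε) * x ^ ε := by ring

theorem exists_norm_completeExpSum_C_mul_le {d : ℕ} (hd : 0 < d) {ε : ℝ} (hε : 0 < ε) :
    ∃ K : ℝ, 0 < K ∧ ∀ (q : ℕ) (f : ℤ[X]), 0 < q → f.natDegree ≤ d →
      NonconstantModPrimeFactors q f → ∀ k : ℕ,
      ‖completeExpSum q (C (k : ℤ) * f)‖ ≤
        K * (q : ℝ) ^ (1 - 1 / (d : ℝ) + ε) * (Nat.gcd k q : ℝ) := by
  obtain ⟨K, hK, hsum⟩ := exists_norm_completeExpSum_le hd hε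
  refine ⟨K, hK, fun q f hq hfd hf k => ?_⟩
  have hexp : 0 ≤ 1 - 1 / (d : ℝ) + ε := by
    have := Nat.cast_inv_le_one (α := ℝ) d
    rw [one_div]
    linarith
  have hg : 0 < Nat.gcd k q := Nat.gcd_pos_of_pos_right k hq
  obtain ⟨k', q', hcop, hk, hq'⟩ := Nat.exists_coprime k q
  set g := Nat.gcd k q
  have hred : completeExpSum q (C (k : ℤ) * f) = g * completeExpSum q' (C (k' : ℤ) * f) := by
    rw [hk, hq', mul_comm q', ← completeExpSum_mul_C_mul hg.ne']
    congr 1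
    rw [← mul_assoc, ← C_mul]
    push_cast
    rw [mul_comm (g : ℤ)]
  have hq'q : q' ∣ q := ⟨g, hq'⟩
  have hbound := hsum q' (C (k' : ℤ) * f) (Nat.pos_of_dvd_of_pos hq'q hq)
    ((natDegree_C_mul_le _ f).trans hfd) (hf.C_mul hq'q (Nat.isCoprime_iff_coprime.mpr hcop))
  have hq'le : (q' : ℝ) ≤ q := Nat.cast_le.mpr (Nat.le_of_dvd hq hq'q)
  rw [hred, norm_mul, Complex.norm_natCast, mul_comm]
  gcongr
  exact hbound.trans (by gcongr)

theorem exists_abs_card_filter_eval_emod_sub_le {d : ℕ} (hd : 0 < d) {η : ℝ} (hη : η * d < 1) :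
    ∃ K : ℝ, 0 < K ∧ ∀ (q : ℕ) (f : ℤ[X]), 0 < q → f.natDegree ≤ d →
      NonconstantModPrimeFactors q f → ∀ A B : ℕ, A ≤ B → B ≤ q →
      |(((Finset.range q).filter fun n : ℕ =>
        (A : ℤ) ≤ f.eval (n : ℤ) % q ∧ f.eval (n : ℤ) % q < B).card : ℝ) - (B - A)| ≤
        K * (q : ℝ) ^ (1 - η) := by
  obtain ⟨ε, hε, hεη⟩ : ∃ ε : ℝ, 0 < ε ∧ 1 - 1 / (d : ℝ) + ε + ε + ε = 1 - η :=
    ⟨(1 / d - η) / 3, by have := (lt_div_iff₀ (Nat.cast_pos.mpr hd)).mpr hη; linarith, by ring⟩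
  obtain ⟨K₁, hK₁, hsum⟩ := exists_norm_completeExpSum_C_mul_le hd hε
  obtain ⟨K₂, hK₂, hdivisors⟩ := exists_card_divisors_le hε
  refine ⟨K₁ * (K₂ * (1 + 1 / ε)), by positivity, fun q f hq hfd hf A B hAB hB => ?_⟩
  have hqR : (0 : ℝ) < q := Nat.cast_pos.mpr hq
  have hcount := abs_card_filter_emod_sub_le (Finset.range q) (fun n => f.eval (n : ℤ)) hq hAB hB
  rw [Finset.card_range, mul_div_cancel_left₀ _ hqR.ne'] at hcount
  have hsum' (k : ℕ) : ‖∑ n ∈ Finset.range q, modChar q (k * f.eval (n : ℤ))‖ ≤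
      K₁ * (q : ℝ) ^ (1 - 1 / (d : ℝ) + ε) * (Nat.gcd k q : ℝ) := by
    simpa only [completeExpSum, eval_C_mul] using hsum q f hq hfd hf k
  calc _ ≤ ∑ k ∈ Finset.Ico 1 q, ‖∑ n ∈ Finset.range q, modChar q (k * f.eval (n : ℤ))‖ / k :=
        hcount
    _ ≤ ∑ k ∈ Finset.Ico 1 q, K₁ * (q : ℝ) ^ (1 - 1 / (d : ℝ) + ε) * ((Nat.gcd k q : ℝ) / k) := by
        simp only [← mul_div_assoc]
        gcongr with k
        exact hsum' k
    _ ≤ K₁ * (q : ℝ) ^ (1 - 1 / (d : ℝ) + ε) *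
          (K₂ * (q : ℝ) ^ ε * ((1 + 1 / ε) * (q : ℝ) ^ ε)) := by
        rw [← Finset.mul_sum]
        gcongr
        refine (sum_Ico_gcd_div_le q).trans ?_
        gcongr
        exacts [hdivisors q hq, one_add_log_le_mul_rpow (Nat.one_le_cast.mpr hq) hε]
    _ = K₁ * (K₂ * (1 + 1 / ε)) *
          ((q : ℝ) ^ (1 - 1 / (d : ℝ) + ε) * (q : ℝ) ^ ε * (q : ℝ) ^ ε) := by
        ring
    _ = K₁ * (K₂ * (1 + 1 / ε)) * (q : ℝ) ^ (1 - η) := by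
        rw [← Real.rpow_add hqR, ← Real.rpow_add hqR, hεη]

end ResidueCounts

section Discrepancy

theorem coeffGcd_pos (d : ℕ) (P : ℤ[X]) {q : ℕ} (hq : 0 < q) : 0 < coeffGcd d P q :=
  Nat.gcd_pos_of_pos_right _ hq

theorem coeffGcd_dvd (d : ℕ) (P : ℤ[X]) (q : ℕ) : coeffGcd d P q ∣ q :=
  Nat.gcd_dvd_right _ _

theorem dvd_coeffGcd_iff {d : ℕ} {P : ℤ[X]} {q m : ℕ} (hP : P.natDegree ≤ d) :
    m ∣ coeffGcd d P q ↔ (∀ j ≠ 0, (m : ℤ) ∣ P.coeff j) ∧ m ∣ q := by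
  simp only [coeffGcd, Nat.dvd_gcd_iff, Finset.dvd_gcd_iff, Finset.mem_Icc, ← Int.natCast_dvd]
  refine and_congr_left' ⟨fun h j hj => ?_, fun h j hj => h j (by omega)⟩
  rcases le_or_gt j d with hjd | hjd
  · exact h j ⟨Nat.one_le_iff_ne_zero.mpr hj, hjd⟩
  · rw [coeff_eq_zero_of_natDegree_lt (hP.trans_lt hjd)]
    exact dvd_zero _

theorem exists_eq_C_add_C_mul {P : ℤ[X]} {g : ℕ} (hg : 0 < g)
    (hdvd : ∀ j ≠ 0, (g : ℤ) ∣ P.coeff j) :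
    ∃ (r : ℤ) (f : ℤ[X]), 0 ≤ r ∧ r < g ∧ P = C r + C (g : ℤ) * f ∧
      f.natDegree = P.natDegree := by
  have hgZ : (0 : ℤ) < g := Nat.cast_pos.mpr hg
  obtain ⟨f, hf⟩ : C (g : ℤ) ∣ P - C (P.coeff 0 % g) := by
    rw [C_dvd_iff_dvd_coeff]
    intro j
    rcases eq_or_ne j 0 with rfl | hj
    · rw [coeff_sub, coeff_C_zero]
      exact Int.dvd_self_sub_emod
    · rw [coeff_sub, coeff_C_of_ne_zero hj, sub_zero]
      exact hdvd j hj
  refine ⟨P.coeff 0 % g, f, Int.emod_nonneg _ hgZ.ne', Int.emod_lt_of_pos _ hgZ, ?_, ?_⟩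
  · rw [← hf, add_sub_cancel]
  · rw [← natDegree_C_mul (p := f) hgZ.ne', ← hf, natDegree_sub_C]

theorem nonconstantModPrimeFactors_of_coeffGcd_eq {d : ℕ} {f : ℤ[X]} {r : ℤ} {q g : ℕ}
    (hg : 0 < g) (hfd : f.natDegree ≤ d) (hgcd : coeffGcd d (C r + C (g : ℤ) * f) (g * q) = g) :
    NonconstantModPrimeFactors q f := by
  intro p hp hpq
  by_contra hdeg
  have hcoeff : ∀ j ≠ 0, (p : ℤ) ∣ f.coeff j := fun j hj => by
    rw [← coeff_reduceMod_eq_zero_iff]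
    exact coeff_eq_zero_of_natDegree_lt (by omega)
  have hdvd : g * p ∣ coeffGcd d (C r + C (g : ℤ) * f) (g * q) := by
    refine (dvd_coeffGcd_iff ?_).mpr ⟨fun j hj => ?_, mul_dvd_mul_left g hpq⟩
    · rw [add_comm, natDegree_add_C]
      exact (natDegree_C_mul_le _ f).trans hfd
    · rw [coeff_add, coeff_C_of_ne_zero hj, zero_add, coeff_C_mul, Nat.cast_mul]
      exact mul_dvd_mul_left _ (hcoeff j hj)
  rw [hgcd] at hdvd
  exact hp.one_lt.not_ge <| Nat.le_of_mul_le_mul_left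
    ((Nat.le_of_dvd hg hdvd).trans_eq (mul_one g).symm) hg

theorem card_filter_Icc_mul_of_periodic {q : ℕ} {p : ℕ → Prop} [DecidablePred p]
    (hp : Function.Periodic p q) (g : ℕ) :
    ((Finset.Icc 1 (q * g)).filter p).card = g * ((Finset.range q).filter p).card := by
  have hper : Function.Periodic (fun n => if p n then 1 else 0) q := fun n => by simp only [hp n]
  have hperg : Function.Periodic p (q * g) := mul_comm g q ▸ hp.nat_mul g
  rw [← Finset.Ico_add_one_right_eq_Icc, add_comm (q * g),
    Nat.filter_Ico_card_eq_of_periodic _ _ p hperg, Nat.count_eq_card_filter_range,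
    Finset.card_filter, Finset.card_filter, sum_range_mul_of_periodic hper, smul_eq_mul]

theorem fract_add_intCast_div {ρ : ℝ} (h0 : 0 ≤ ρ) (h1 : ρ < 1) {q : ℕ} (hq : 0 < q) (z : ℤ) :
    Int.fract ((ρ + z) / q) = (ρ + (z % q : ℤ)) / q := by
  have hqR : (0 : ℝ) < q := Nat.cast_pos.mpr hq
  have hz0 : (0 : ℝ) ≤ (z % q : ℤ) := Int.cast_nonneg (Int.emod_nonneg z (by omega))
  have hz1 : ((z % q : ℤ) : ℝ) + 1 ≤ q := by
    exact_mod_cast Int.emod_lt_of_pos z (Nat.cast_pos.mpr hq)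
  have hdiv : (z : ℝ) = (z % q : ℤ) + q * (z / q : ℤ) := by
    exact_mod_cast (Int.emod_add_mul_ediv z q).symm
  refine Int.fract_eq_iff.mpr ⟨by positivity, (div_lt_one hqR).mpr (by linarith), z / q, ?_⟩
  rw [← sub_div, add_sub_add_left_eq_sub, hdiv, add_sub_cancel_left,
    mul_div_cancel_left₀ _ hqR.ne']

theorem le_fract_add_intCast_div_iff {ρ : ℝ} (h0 : 0 ≤ ρ) (h1 : ρ < 1) {q : ℕ} (hq : 0 < q)
    (z : ℤ) (t : ℝ) : t ≤ Int.fract ((ρ + z) / q) ↔ ((⌈t * q - ρ⌉₊ : ℕ) : ℤ) ≤ z % q := by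
  obtain ⟨m, hm⟩ := Int.eq_ofNat_of_zero_le (Int.emod_nonneg z (by omega : (q : ℤ) ≠ 0))
  rw [fract_add_intCast_div h0 h1 hq, hm, Int.cast_natCast, Int.ofNat_le, Nat.ceil_le,
    le_div_iff₀ (Nat.cast_pos.mpr hq), sub_le_iff_le_add']

theorem abs_ceil_sub_ceil_sub_le {a b : ℝ} (ha : -1 < a) (hb : -1 < b) :
    |((⌈b⌉₊ : ℝ) - ⌈a⌉₊) - (b - a)| ≤ 1 := by
  have hceil {t : ℝ} (ht : -1 < t) : (⌈t⌉₊ : ℝ) ≤ t + 1 := by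
    rcases le_total 0 t with h | h
    · exact (Nat.ceil_lt_add_one h).le
    · rw [Nat.ceil_eq_zero.mpr h, Nat.cast_zero]; linarith
  rw [abs_le]
  constructor <;> linarith [Nat.le_ceil a, Nat.le_ceil b, hceil ha, hceil hb]

theorem discrepancy_add_intCast_div_le {ρ : ℝ} (h0 : 0 ≤ ρ) (h1 : ρ < 1) {q : ℕ} (hq : 0 < q)
    {N : ℕ} {y : ℕ → ℤ} {E : ℝ}
    (hE : ∀ A B : ℕ, A ≤ B → B ≤ q →
      |(((Finset.Icc 1 N).filter fun n => (A : ℤ) ≤ y n % q ∧ y n % q < B).card : ℝ) / N -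
        ((B : ℝ) - A) / q| ≤ E) :
    discrepancy N (fun n => (ρ + y n) / q) ≤ E + 1 / q := by
  have hqR : (0 : ℝ) < q := Nat.cast_pos.mpr hq
  have hE0 : 0 ≤ E := (abs_nonneg _).trans (hE 0 0 le_rfl q.zero_le)
  refine Real.sSup_le ?_ (by positivity)
  rintro _ ⟨α, β, hα, hαβ, hβ, rfl⟩
  have hset : {n : ℕ | n ∈ Finset.Icc 1 N ∧
      α ≤ Int.fract ((ρ + y n) / q) ∧ Int.fract ((ρ + y n) / q) < β} =
      ((Finset.Icc 1 N).filter fun n => ((⌈α * q - ρ⌉₊ : ℕ) : ℤ) ≤ y n % q ∧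
        y n % q < ((⌈β * q - ρ⌉₊ : ℕ) : ℤ)) := by
    ext n
    simp only [Set.mem_ofPred_eq, Finset.coe_filter, ← not_le,
      le_fract_add_intCast_div_iff h0 h1 hq]
  have hcount := hE ⌈α * q - ρ⌉₊ ⌈β * q - ρ⌉₊ (Nat.ceil_mono (by gcongr)) <| Nat.ceil_le.mpr <| by
    linarith [mul_le_of_le_one_left hqR.le hβ]
  have hlow {t : ℝ} (ht : 0 ≤ t) : -1 < t * q - ρ := by linarith [mul_nonneg ht hqR.le]
  have hceil : |((⌈β * q - ρ⌉₊ : ℝ) - ⌈α * q - ρ⌉₊) / q - (β - α)| ≤ 1 / q := by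
    have habs := abs_ceil_sub_ceil_sub_le (hlow hα) (hlow (hα.trans hαβ))
    rw [sub_sub_sub_cancel_right, ← sub_mul] at habs
    rw [div_sub' hqR.ne', mul_comm (q : ℝ), abs_div, abs_of_pos hqR]
    gcongr
  rw [hset, Set.ncard_coe_finset, ← sub_add_sub_cancel _
    (((⌈β * q - ρ⌉₊ : ℝ) - ⌈α * q - ρ⌉₊) / q)]
  exact (abs_add_le _ _).trans (add_le_add hcount hceil)

theorem discrepancy_le_one (N : ℕ) (x : ℕ → ℝ) : discrepancy N x ≤ 1 := by
  refine Real.sSup_le ?_ zero_le_one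
  rintro _ ⟨α, β, hα, hαβ, hβ, rfl⟩
  set s := {n : ℕ | n ∈ Finset.Icc 1 N ∧ α ≤ Int.fract (x n) ∧ Int.fract (x n) < β}
  have hcard : s.ncard ≤ N := by
    simpa using Set.ncard_le_ncard (fun n hn => hn.1 : s ⊆ (Finset.Icc 1 N : Finset ℕ))
  have hle : (s.ncard : ℝ) / N ≤ 1 := div_le_one_of_le₀ (Nat.cast_le.mpr hcard) N.cast_nonneg
  have hnonneg : 0 ≤ (s.ncard : ℝ) / N := by positivity
  rw [abs_le]
  constructor <;> linarith

theorem discrepancy_eval_div_le {q g : ℕ} (hq : 0 < q) (hg : 0 < g) {r : ℤ} (hr0 : 0 ≤ r)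
    (hrg : r < g) (f : ℤ[X]) {E : ℝ}
    (hE : ∀ A B : ℕ, A ≤ B → B ≤ q → |(((Finset.range q).filter fun n : ℕ =>
      (A : ℤ) ≤ f.eval (n : ℤ) % q ∧ f.eval (n : ℤ) % q < B).card : ℝ) - (B - A)| ≤ E) :
    discrepancy (q * g)
      (fun n => (((C r + C (g : ℤ) * f).eval (n : ℤ) : ℤ) : ℝ) / ((q * g : ℕ) : ℝ)) ≤
      (E + 1) / q := by
  have hqR : (0 : ℝ) < q := Nat.cast_pos.mpr hq
  have hgR : (0 : ℝ) < g := Nat.cast_pos.mpr hg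
  have hseq : (fun n : ℕ => (((C r + C (g : ℤ) * f).eval (n : ℤ) : ℤ) : ℝ) / ((q * g : ℕ) : ℝ)) =
      fun n : ℕ => ((r / g : ℝ) + (f.eval (n : ℤ) : ℤ)) / q := by
    funext n
    rw [eval_add, eval_C_mul, eval_C]
    push_cast
    field_simp
  rw [hseq, add_div]
  refine discrepancy_add_intCast_div_le (by positivity)
    ((div_lt_one hgR).mpr (by exact_mod_cast hrg)) hq fun A B hAB hB => ?_
  have hper : Function.Periodic
      (fun n : ℕ => (A : ℤ) ≤ f.eval (n : ℤ) % q ∧ f.eval (n : ℤ) % q < B) q := fun n => by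
    have hmod : f.eval ((n + q : ℕ) : ℤ) % q = f.eval (n : ℤ) % q :=
      polynomial_eval_modEq (by simp [Int.ModEq]) f
    simp only [hmod]
  rw [card_filter_Icc_mul_of_periodic hper]
  push_cast
  rw [mul_comm (q : ℝ), mul_div_mul_left _ _ hgR.ne', ← sub_div, abs_div, abs_of_pos hqR]
  gcongr
  exact hE A B hAB hB

theorem mainTheorem9_general (d : ℕ) {η : ℝ} (hη : η * d < 1) :
    ∃ C : ℝ, 0 < C ∧ ∀ (P : ℤ[X]) (q : ℕ), P.natDegree ≤ d → 0 < q →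
      discrepancy q (fun n => ((P.eval (n : ℤ) : ℤ) : ℝ) / (q : ℝ)) ≤
        C * ((q : ℝ) / (coeffGcd d P q : ℝ)) ^ (-η) := by
  rcases d.eq_zero_or_pos with rfl | hd
  · refine ⟨1, one_pos, fun P q _ hq => (discrepancy_le_one q _).trans ?_⟩
    simp [coeffGcd, hq.ne']
  obtain ⟨K, hK, hcount⟩ := exists_abs_card_filter_eval_emod_sub_le hd hη
  refine ⟨K + 1, by positivity, fun P q hP hq => ?_⟩
  have hg := coeffGcd_pos d P hq
  obtain ⟨q', hq'⟩ := coeffGcd_dvd d P q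
  obtain ⟨r, f, hr0, hrg, hPf, hfP⟩ :=
    exists_eq_C_add_C_mul hg ((dvd_coeffGcd_iff hP).mp dvd_rfl).1
  have hf : NonconstantModPrimeFactors q' f :=
    nonconstantModPrimeFactors_of_coeffGcd_eq hg (hfP.trans_le hP) (by rw [← hPf, ← hq'])
  generalize coeffGcd d P q = g at *
  subst hq' hPf
  have hq'0 : 0 < q' := Nat.pos_of_mul_pos_left hq
  have hq'R : (0 : ℝ) < q' := Nat.cast_pos.mpr hq'0
  have hη1 : η ≤ 1 := by
    have hd1 : (1 : ℝ) ≤ d := Nat.one_le_cast.mpr hd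
    by_contra!
    nlinarith
  have hone : 1 ≤ (q' : ℝ) ^ (1 - η) :=
    Real.one_le_rpow (Nat.one_le_cast.mpr hq'0) (sub_nonneg.mpr hη1)
  have hdisc := discrepancy_eval_div_le hq'0 hg hr0 hrg f (hcount q' f hq'0 (hfP.trans_le hP) hf)
  rw [mul_comm q'] at hdisc
  refine hdisc.trans ?_
  calc (K * (q' : ℝ) ^ (1 - η) + 1) / q' ≤ (K + 1) * (q' : ℝ) ^ (1 - η) / q' := by
        gcongr
        linarith
    _ = (K + 1) * (((g * q' : ℕ) : ℝ) / g) ^ (-η) := by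
        rw [Nat.cast_mul, mul_div_cancel_left₀ _ (Nat.cast_ne_zero.mpr hg.ne'), mul_div_assoc,
          ← Real.rpow_sub_one hq'R.ne', sub_sub_cancel_left]

end Discrepancy

theorem mainTheorem9 (d : ℕ) :
    ∃ C : ℝ, 0 < C ∧ ∀ (P : Polynomial ℤ) (q : ℕ), P.natDegree = d → 0 < q →
      discrepancy q (fun n => ((P.eval (n : ℤ) : ℤ) : ℝ) / (q : ℝ)) ≤
        C * ((q : ℝ) / (coeffGcd d P q : ℝ)) ^ (-(1 / ((d : ℝ) + 1))) := by
  obtain ⟨C, hC, h⟩ := mainTheorem9_general d (η := 1 / ((d : ℝ) + 1))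
    (by rw [one_div_mul_eq_div, div_lt_one (by positivity)]; linarith)
  exact ⟨C, hC, fun P q hP => h P q hP.le⟩
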